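/- Let $\mathbb F_q$ be the finite field with $q$ elements, let $\zeta\in\mathbb F_q^\times$, and let $m$ be the multiplicative order of $\zeta$. For $n\ge 0$ let $$K_{\zeta,n}(\mathbb F_q)=\{(A,B)\in \mathrm{Mat}_n(\mathbb F_q)\times \mathrm{Mat}_n(\mathbb F_q): AB=\zeta BA\}.$$ Then the following identity of power series in $x$ with real coefficients holds: $$\sum_{n=0}^\infty \frac{|K_{\zeta,n}(\mathbb F_q)|}{(q^n-1)(q^n-q)\cdots(q^n-q^{n-1})}\,x^n=\prod_{i=1}^\infty F_m(x^i;q),$$ where $$F_m(x;q)=\frac{1-x^m}{(1-x)(1-x^mq)}\cdot\frac{1}{(1-x)(1-xq^{-1})(1-xq^{-2})\cdots},$$ and all infinite products converge coefficientwise. (The denominator on the left is $|\mathrm{GL}_n(\mathbb F_q)|$.) In particular, for fixed $q$ and $n$, $|K_{\zeta,n}(\mathbb F_q)|$ depends only on the order $m$ of $\zeta$. For $m=1$, that is $\zeta=1$, $K_{1,n}(\mathbb F_q)$ is the set of pairs of commuting matrices and the identity becomes the formula of Feit and Fine, $$\sum_{n=0}^\infty \frac{|K_{1,n}(\mathbb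 F_q)|}{(q^n-1)(q^n-q)\cdots(q^n-q^{n-1})}\,x^n=\prod_{i\ge1}\prod_{j\ge0}\frac{1}{1-q^{1-j}x^i}.$$ -/

import Mathlib

open scoped PowerSeries.WithPiTopology

namespace QuantumPlane

/-- The set of pairs `(A, B)` of `n × n` matrices over `F` with `A B = ζ B A`. -/
def zetaCommuting {F : Type*} [Field F] (ζ : F) (n : ℕ) :
    Set (Matrix (Fin n) (Fin n) F × Matrix (Fin n) (Fin n) F) :=
  {p | p.1 * p.2 = ζ • (p.2 * p.1)}

/-- The real number `(q^n - 1)(q^n - q) ⋯ (q^n - q^(n-1))`. -/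
def glOrder (q : ℝ) (n : ℕ) : ℝ :=
  ∏ k ∈ Finset.range n, (q ^ n - q ^ k)

/-- The generating function `∑ c(n) / ((q^n - 1) ⋯ (q^n - q^(n-1))) x^n`. -/
noncomputable def normalizedSeries (q : ℝ) (c : ℕ → ℕ) : PowerSeries ℝ :=
  PowerSeries.mk fun n => (c n : ℝ) / glOrder q n

/-- The factor `1 - x q^(-j)`. -/
noncomputable def eulerFactor (q : ℝ) (j : ℕ) : PowerSeries ℝ :=
  1 - PowerSeries.C (q ^ (-(j : ℤ))) * PowerSeries.X

/-- The power series
`F_m(x; q) = (1 - x^m) / ((1 - x)(1 - x^m q)) * 1 / ((1 - x)(1 - x q⁻¹)(1 - x q⁻²) ⋯)`.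
Power series carry the topology of coefficientwise convergence in `ℝ`. -/
noncomputable def quantumFactor (m : ℕ) (q : ℝ) : PowerSeries ℝ :=
  (1 - PowerSeries.X ^ m) *
      ((1 - PowerSeries.X) * (1 - PowerSeries.C q * PowerSeries.X ^ m))⁻¹ *
    (∏' j : ℕ, eulerFactor q j)⁻¹

end QuantumPlane

/-!
Write `k(n)` for the number of pairs `(A, B)` of `n × n` matrices over `𝔽_q` with `A B = ζ B A`. The
generating function of `k(n) / |GL_n|` is computed by two recursions of the same shape, both
resolved by `mk_sum_eq_tprod_mul`: if `u n a = ∑_{b ≤ a} w (a - b) * u (n - a) b` for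
`1 ≤ a ≤ n`, then `∑ₙ xⁿ ∑ₐ u n a = ∏_{i ≥ 1} w(xⁱ) * ∑ₙ u n 0 * xⁿ`.

For the first, sort the pairs by `a = dim ker A`. Writing `A = ι ∘ π` as an injection after a
surjection, through a space `U` of dimension `n - a`, the pair `(A, B)` induces a pair
`(π ∘ ι, B')` of the same kind on `U`. The number of ways to go back depends on dimensions only, so
the recursion holds with `w c = q ^ (c ^ 2) / |GL_c|`, for every `ζ ≠ 0`
(`nullityRatio_recursion`). By Euler's identity `w(x) = ∏_{j ≥ 0} 1 / (1 - x q⁻ʲ)`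
(`tprod_eulerFactor_mul`). The column `a = 0` counts the pairs with `A` invertible.

A Burnside count (`natCard_nullityPair_zero`) turns that column into the number of similarity
classes of endomorphisms `B` with `B ∼ ζ B`. For the second recursion, sort these by the degree
`a` of the minimal polynomial `f` of `B`. Splitting off the cyclic module `F[X] / (f)` leaves a
class on a space of dimension `n - a` whose minimal polynomial `g` divides `f`. This class is unique
because finite modules cancel (`nonempty_linearEquiv_of_prod`), and it is again stable under `ζ`.
The condition on `f` is `f(ζ X) = ζ ^ deg f * f(X)`, hence the same for the monic cofactor `f / g`,
which leaves `q ^ ⌊c / m⌋` choices in degree `c` (`natCard_monicHomogeneous`). So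
`w(x) = ∑ q ^ ⌊c / m⌋ * x ^ c = (1 - x ^ m) / ((1 - x) (1 - q x ^ m))`, and the column `a = 0` is
`1`.
-/

namespace QuantumPlane

/-! ### Power series: products of `w(xⁱ)` and Euler's identity -/

section Series
open Filter Topology Finset PowerSeries

theorem coeff_expand_mul_eq_sum (p : ℕ) (w : ℕ → ℝ) (f : PowerSeries ℝ) (n : ℕ) :
    coeff n (expand (p + 1) p.succ_ne_zero (mk w) * f) =
      ∑ c ∈ range (n + 1), if (p + 1) * c ≤ n then w c * coeff (n - (p + 1) * c) f else 0 := by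
  rw [coeff_mul, Nat.sum_antidiagonal_eq_sum_range_succ_mk, ← Finset.sum_filter]
  symm
  refine Finset.sum_of_injOn (fun c => (p + 1) * c) ?_ ?_ ?_ ?_
  · intro a _ b _ h
    exact Nat.eq_of_mul_eq_mul_left p.succ_pos h
  · intro c hc
    simp at hc ⊢
    omega
  · intro i hi hi'
    have : ¬ (p + 1) ∣ i := by
      rintro ⟨c, rfl⟩
      apply hi'
      refine ⟨c, ?_, rfl⟩
      simp at hi ⊢
      have : c ≤ (p + 1) * c := Nat.le_mul_of_pos_left _ p.succ_pos
      omega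
    simp only
    rw [coeff_expand_of_not_dvd _ _ _ this, zero_mul]
  · intro c hc
    simp only
    rw [coeff_expand_mul, coeff_mk]

theorem multipliable_expand (w : ℕ → ℝ) (hw : w 0 = 1) :
    Multipliable fun i : ℕ => expand (i + 1) i.succ_ne_zero (mk w) := by
  have h := PowerSeries.WithPiTopology.multipliable_one_add_of_tendsto_order_atTop_nhds_top ℝ
    (f := fun i : ℕ => expand (i + 1) i.succ_ne_zero (mk w) - 1) ?_
  · simpa using h
  · rw [ENat.tendsto_nhds_top_iff_natCast_lt]
    intro n
    filter_upwards [eventually_ge_atTop n] with i hi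
    refine lt_of_lt_of_le (b := ((i + 1 : ℕ) : ℕ∞)) (by exact_mod_cast Nat.lt_succ_of_le hi) ?_
    refine PowerSeries.nat_le_order _ _ fun j hj => ?_
    rw [map_sub, coeff_expand, coeff_one]
    rcases Nat.eq_zero_or_pos j with rfl | hj0
    · simp [hw]
    · rw [if_neg (Nat.not_dvd_of_pos_of_lt hj0 hj), if_neg hj0.ne', sub_zero]

/-- If `u n a` vanishes for `a > n` and satisfies
`u n a = ∑_{b ≤ a} w (a - b) * u (n - a) b` for `1 ≤ a ≤ n`, then the row sums of `u` have
generating function `∏ᵢ w(xⁱ)` times the generating function of the column `a = 0`.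
With `Φ k = ∑_{n, a} u n a * x ^ (n + k * a)` the recursion says
`Φ k = w(x ^ (k + 1)) * Φ (k + 1)`, and `Φ k` converges to the column `a = 0`. -/
theorem mk_sum_eq_tprod_mul (w : ℕ → ℝ) (hw : w 0 = 1) (u : ℕ → ℕ → ℝ)
    (hu0 : ∀ n a, n < a → u n a = 0)
    (hu : ∀ n a, 1 ≤ a → a ≤ n → u n a = ∑ b ∈ range (a + 1), w (a - b) * u (n - a) b) :
    (mk fun n => ∑ a ∈ range (n + 1), u n a) =
      (∏' i : ℕ, expand (i + 1) i.succ_ne_zero (mk w)) * mk fun n => u n 0 := by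
  set Φ : ℕ → PowerSeries ℝ := fun k =>
    mk fun n => ∑ a ∈ range (n + 1), if k * a ≤ n then u (n - k * a) a else 0 with hΦ
  have hext (k n N : ℕ) (h : n ≤ N) :
      coeff n (Φ k) = ∑ a ∈ range (N + 1), if k * a ≤ n then u (n - k * a) a else 0 := by
    rw [hΦ, coeff_mk]
    refine sum_subset (range_mono (by omega)) fun a _ ha => ?_
    simp only [mem_range] at ha
    split_ifs with hk
    · exact hu0 _ _ (by omega)
    · rfl
  have step (k : ℕ) : Φ k = expand (k + 1) k.succ_ne_zero (mk w) * Φ (k + 1) := by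
    ext n
    rw [coeff_expand_mul_eq_sum]
    set g : ℕ → ℕ → ℝ := fun b c =>
      if (k + 1) * (b + c) ≤ n then w c * u (n - (k + 1) * (b + c)) b else 0 with hg
    have h1 : coeff n (Φ k) = ∑ a ∈ range (n + 1), ∑ b ∈ range (a + 1), g b (a - b) := by
      rw [hext k n n le_rfl]
      refine sum_congr rfl fun a _ => ?_
      have hb : ∀ b ∈ range (a + 1), g b (a - b) =
          if (k + 1) * a ≤ n then w (a - b) * u (n - (k + 1) * a) b else 0 := by
        intro b hb
        rw [mem_range] at hb
        simp only [hg]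
        rw [Nat.add_sub_cancel' (by omega)]
      rw [sum_congr rfl hb]
      have hka : (k + 1) * a = k * a + a := by ring
      by_cases h1 : (k + 1) * a ≤ n
      · simp only [if_pos h1]
        rw [if_pos (by omega)]
        rcases Nat.eq_zero_or_pos a with rfl | ha
        · simp [hw]
        · rw [hu _ a ha (by omega), Nat.sub_sub, hka]
      · simp only [if_neg h1, sum_const_zero]
        split_ifs with h2
        · exact hu0 _ _ (by omega)
        · rfl
    rw [h1, sum_range_diag_flip (n + 1) g, sum_comm' (t' := range (n + 1))
      (s' := fun c => range (n + 1 - c)) (by intro x y; simp only [mem_range]; omega)]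
    refine sum_congr rfl fun c _ => ?_
    have hkc : c ≤ (k + 1) * c := Nat.le_mul_of_pos_left _ k.succ_pos
    split_ifs with h2
    · rw [hext (k + 1) _ (n - c) (by omega), mul_sum]
      have h3 : n + 1 - c = n - c + 1 := by omega
      rw [h3]
      refine sum_congr rfl fun b _ => ?_
      simp only [hg, mul_add, mul_ite, mul_zero]
      rw [Nat.sub_sub, Nat.add_comm ((k + 1) * c)]
      exact if_congr (by omega) rfl rfl
    · refine sum_eq_zero fun b _ => ?_
      simp only [hg, mul_add]
      rw [if_neg (by omega)]
  have partialProd (k : ℕ) :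
      Φ 0 = (∏ i ∈ range k, expand (i + 1) i.succ_ne_zero (mk w)) * Φ k := by
    induction k with
    | zero => simp
    | succ k ih => rw [ih, prod_range_succ, mul_assoc, ← step k]
  have hΦ0 : Φ 0 = mk fun n => ∑ a ∈ range (n + 1), u n a := by
    ext n
    simp [hΦ]
  have hlim : Tendsto Φ atTop (𝓝 (mk fun n => u n 0)) := by
    rw [PowerSeries.WithPiTopology.tendsto_iff_coeff_tendsto]
    intro n
    refine tendsto_const_nhds.congr' ?_
    filter_upwards [eventually_gt_atTop n] with k hk
    rw [hΦ, coeff_mk, coeff_mk, sum_eq_single 0]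
    · simp
    · intro a _ ha
      rw [if_neg]
      have : k ≤ k * a := Nat.le_mul_of_pos_right _ (Nat.pos_of_ne_zero ha)
      omega
    · simp
  rw [← hΦ0]
  refine tendsto_nhds_unique ?_ ((multipliable_expand w hw).hasProd.tendsto_prod_nat.mul hlim)
  exact tendsto_const_nhds.congr partialProd

theorem multipliable_one_sub_C_mul_X_pow (c : ℕ → ℝ) (hc : Summable fun j => ‖c j‖) (d : ℕ) :
    Multipliable fun j => (1 - C (c j) * X ^ (d + 1) : PowerSeries ℝ) := by
  have key : Multipliable fun j => (1 + C (-c j) * X ^ (d + 1) : PowerSeries ℝ) := by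
    refine multipliable_one_add_of_summable_prod ?_
    rw [PowerSeries.WithPiTopology.summable_iff_summable_coeff]
    intro n
    have hs : Summable fun s : Finset ℕ => ∏ j ∈ s, (-c j) :=
      summable_finsetProd_of_summable_norm (by simpa using hc)
    refine Summable.of_norm_bounded hs.norm fun s => ?_
    rw [prod_mul_distrib, ← map_prod, coeff_C_mul, prod_const, ← pow_mul, coeff_X_pow]
    split_ifs
    · simp
    · simpa using prod_nonneg fun i _ => abs_nonneg (c i)
  simpa [sub_eq_add_neg] using key

/-- Euler's coefficients: the coefficient `q ^ (c ^ 2) / |GL_c(𝔽_q)|` of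
`∏_{j ≥ 0} 1 / (1 - x q⁻ʲ)`. -/
noncomputable def eulerCoeff (q : ℝ) (c : ℕ) : ℝ := q ^ (c ^ 2) / glOrder q c

theorem glOrder_pos {q : ℝ} (hq : 1 < q) (n : ℕ) : 0 < glOrder q n :=
  prod_pos fun _ hk => sub_pos.2 (pow_lt_pow_right₀ hq (mem_range.1 hk))

theorem glOrder_add (q : ℝ) (r a : ℕ) :
    glOrder q (r + a) = (∏ k ∈ range r, (q ^ (r + a) - q ^ k)) * q ^ (r * a) * glOrder q a := by
  rw [glOrder, prod_range_add, mul_assoc]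
  congr 1
  have : ∀ k ∈ range a, q ^ (r + a) - q ^ (r + k) = q ^ r * (q ^ a - q ^ k) := by
    intro k _
    ring
  rw [prod_congr rfl this, prod_mul_distrib, prod_const, card_range, ← pow_mul, glOrder]

theorem eulerCoeff_zero (q : ℝ) : eulerCoeff q 0 = 1 := by simp [eulerCoeff, glOrder]

theorem eulerCoeff_succ {q : ℝ} (hq : 1 < q) (c : ℕ) :
    eulerCoeff q (c + 1) * (1 - (q⁻¹) ^ (c + 1)) = eulerCoeff q c := by
  have h := glOrder_add q 1 c
  have h0 := (glOrder_pos hq (c + 1)).ne'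
  have h1 := (glOrder_pos hq c).ne'
  have hq0 : q ≠ 0 := by positivity
  simp only [prod_range_one, pow_zero, one_mul] at h
  rw [add_comm 1 c] at h
  unfold eulerCoeff
  rw [div_mul_eq_mul_div, div_eq_div_iff h0 h1, h, inv_pow]
  field_simp
  ring

theorem multipliable_eulerFactor {q : ℝ} (hq : 1 < q) : Multipliable (eulerFactor q) := by
  have h := multipliable_one_sub_C_mul_X_pow (fun j : ℕ => q ^ (-(j : ℤ))) ?_ 0
  · simp only [zero_add, pow_one] at h
    exact h
  · refine (summable_geometric_of_lt_one (r := q⁻¹) (by positivity)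
      (inv_lt_one_of_one_lt₀ hq)).congr fun j => ?_
    rw [Real.norm_of_nonneg (by positivity), zpow_neg, zpow_natCast, inv_pow]

/-- Euler's identity `∑ q ^ (c ^ 2) / |GL_c(𝔽_q)| * x ^ c = ∏_{j ≥ 0} 1 / (1 - x q⁻ʲ)`: the left
hand side `f` satisfies `(1 - x) f(x) = f(x / q)`. -/
theorem tprod_eulerFactor_mul {q : ℝ} (hq : 1 < q) :
    (∏' j : ℕ, eulerFactor q j) * mk (eulerCoeff q) = 1 := by
  have hq0 : q ≠ 0 := by positivity
  set f : PowerSeries ℝ := mk (eulerCoeff q) with hf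
  have step (k : ℕ) :
      eulerFactor q k * rescale ((q⁻¹) ^ k) f = rescale ((q⁻¹) ^ (k + 1)) f := by
    ext n
    rw [eulerFactor, sub_mul, one_mul, map_sub, mul_assoc, coeff_C_mul, zpow_neg, zpow_natCast,
      ← inv_pow]
    rcases n with _ | n
    · simp
    · rw [coeff_succ_X_mul, coeff_rescale, coeff_rescale, coeff_rescale, hf, coeff_mk, coeff_mk,
        ← eulerCoeff_succ hq n]
      ring
  have partialProd (k : ℕ) :
      (∏ j ∈ range k, eulerFactor q j) * f = rescale ((q⁻¹) ^ k) f := by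
    induction k with
    | zero => simp
    | succ k ih => rw [prod_range_succ, mul_right_comm, ih, mul_comm, step k]
  have hlim : Tendsto (fun k : ℕ => rescale ((q⁻¹) ^ k) f) atTop (𝓝 1) := by
    rw [PowerSeries.WithPiTopology.tendsto_iff_coeff_tendsto]
    intro n
    simp only [coeff_rescale, coeff_one, hf, coeff_mk]
    rcases Nat.eq_zero_or_pos n with rfl | hn
    · simp [eulerCoeff_zero]
    · rw [if_neg hn.ne']
      have h1 : Tendsto (fun k : ℕ => ((q⁻¹) ^ n) ^ k) atTop (𝓝 0) :=
        tendsto_pow_atTop_nhds_zero_of_lt_one (by positivity)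
          (pow_lt_one₀ (by positivity) (inv_lt_one_of_one_lt₀ hq) hn.ne')
      simpa [← pow_mul, mul_comm] using h1.mul_const (eulerCoeff q n)
  refine tendsto_nhds_unique ?_ hlim
  simp only [← partialProd]
  exact (multipliable_eulerFactor hq).hasProd.tendsto_prod_nat.mul_const f

/-- The rational factor `(1 - x ^ m) / ((1 - x) (1 - q x ^ m))` of `quantumFactor m q` is
`∑ q ^ ⌊c / m⌋ * x ^ c`. -/
theorem mk_pow_div_eq (q : ℝ) {m : ℕ} (hm : 0 < m) :
    (1 - X ^ m) * ((1 - X) * (1 - C q * X ^ m))⁻¹ =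
      (mk fun c => q ^ (c / m) : PowerSeries ℝ) := by
  have h1 : (mk fun c => q ^ (c / m) : PowerSeries ℝ) * (1 - C q * X ^ m) =
      ∑ c ∈ range m, X ^ c := by
    ext n
    rw [mul_sub, mul_one, map_sub, ← mul_assoc, coeff_mul_X_pow', coeff_mul_C, coeff_mk, map_sum]
    simp only [coeff_X_pow]
    rw [sum_ite_eq]
    simp only [mem_range]
    split_ifs with h2 h3 h3
    · omega
    · rw [coeff_mk, ← pow_succ, ← Nat.div_eq_sub_div hm h2, sub_self]
    · rw [Nat.div_eq_of_lt h3]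
      simp
    · omega
  symm
  rw [PowerSeries.eq_mul_inv_iff_mul_eq (by simp [hm.ne']), mul_comm (1 - X), ← mul_assoc, h1,
    geom_sum_mul_neg]

theorem quantumFactor_eq {q : ℝ} (hq : 1 < q) {m : ℕ} (hm : 0 < m) :
    quantumFactor m q = (mk fun c => q ^ (c / m)) * mk (eulerCoeff q) := by
  have h := tprod_eulerFactor_mul hq
  rw [quantumFactor, mk_pow_div_eq q hm]
  congr 1
  have h0 : constantCoeff (∏' j : ℕ, eulerFactor q j) ≠ 0 := by
    intro h0
    have := congrArg constantCoeff h
    simp [h0] at this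
  rw [eq_comm, PowerSeries.eq_inv_iff_mul_eq_one h0, mul_comm, h]

theorem hasProd_expand_quantumFactor {q : ℝ} (hq : 1 < q) {m : ℕ} (hm : 0 < m) :
    HasProd (fun i : ℕ => expand (i + 1) i.succ_ne_zero (quantumFactor m q))
      ((∏' i : ℕ, expand (i + 1) i.succ_ne_zero (mk (eulerCoeff q))) *
        ∏' i : ℕ, expand (i + 1) i.succ_ne_zero (mk fun c => q ^ (c / m))) := by
  have h := (multipliable_expand (eulerCoeff q) (eulerCoeff_zero q)).hasProd.mul
    (multipliable_expand (fun c => q ^ (c / m)) (by simp)).hasProd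
  refine h.congr_fun fun i => ?_
  rw [quantumFactor_eq hq hm, map_mul, mul_comm]

theorem multipliable_feitFine {q : ℝ} (hq : 1 < q) (i : ℕ) :
    Multipliable fun j : ℕ => (1 - C (q ^ (1 - (j : ℤ))) * X ^ (i + 1) : PowerSeries ℝ) := by
  refine multipliable_one_sub_C_mul_X_pow _ ?_ i
  have hq0 : q ≠ 0 := by positivity
  have h : Summable fun j : ℕ => q * (q⁻¹) ^ j :=
    (summable_geometric_of_lt_one (by positivity) (inv_lt_one_of_one_lt₀ hq)).mul_left q
  refine h.congr fun j => ?_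
  rw [Real.norm_of_nonneg (by positivity), zpow_sub₀ hq0, zpow_one, zpow_natCast, inv_pow,
    div_eq_mul_inv]

theorem continuous_expand (p : ℕ) (hp : p ≠ 0) :
    Continuous (expand p hp : PowerSeries ℝ → PowerSeries ℝ) := by
  rw [continuous_iff_continuousAt]
  intro f
  rw [ContinuousAt, PowerSeries.WithPiTopology.tendsto_iff_coeff_tendsto]
  intro n
  simp only [coeff_expand]
  split_ifs
  · exact (PowerSeries.WithPiTopology.continuous_coeff ℝ (n / p)).tendsto f
  · exact tendsto_const_nhds

/-- For `m = 1` the rational factor of `quantumFactor` reduces to `1 / (1 - q x)`, which is the term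
`j = 0` of the product of Feit and Fine. -/
theorem inv_tprod_feitFine {q : ℝ} (hq : 1 < q) (i : ℕ) :
    (∏' j : ℕ, (1 - C (q ^ (1 - (j : ℤ))) * X ^ (i + 1) : PowerSeries ℝ))⁻¹ =
      expand (i + 1) i.succ_ne_zero (quantumFactor 1 q) := by
  set E : PowerSeries ℝ := ∏' j : ℕ, eulerFactor q j with hE
  have hE1 : E * mk (eulerCoeff q) = 1 := tprod_eulerFactor_mul hq
  have htail : HasProd (fun j : ℕ => (1 - C (q ^ (1 - ((j + 1 : ℕ) : ℤ))) * X ^ (i + 1) :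
      PowerSeries ℝ)) (expand (i + 1) i.succ_ne_zero E) := by
    have := (multipliable_eulerFactor hq).hasProd.map
      (expand (i + 1) i.succ_ne_zero : PowerSeries ℝ →ₐ[ℝ] PowerSeries ℝ)
      (continuous_expand (i + 1) i.succ_ne_zero)
    refine this.congr_fun fun j => ?_
    simp [eulerFactor, sub_eq_add_neg, expand_C]
  have hall := htail.zero_mul
    (f := fun j : ℕ => (1 - C (q ^ (1 - (j : ℤ))) * X ^ (i + 1) : PowerSeries ℝ))
  rw [hall.tprod_eq]
  have hgeom := mk_pow_div_eq q one_pos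
  have h2 : (1 - C q * X) * (mk fun c => q ^ (c / 1) : PowerSeries ℝ) = 1 := by
    rw [← hgeom, pow_one]
    have h3 : ((1 : PowerSeries ℝ) - X) * (1 - C q * X) * ((1 - X) * (1 - C q * X))⁻¹ = 1 :=
      PowerSeries.mul_inv_cancel _ (by simp)
    linear_combination h3
  have h4 : (1 - C (q ^ (1 - ((0 : ℕ) : ℤ))) * X ^ (i + 1) : PowerSeries ℝ) =
      expand (i + 1) i.succ_ne_zero (1 - C q * X) := by
    simp [expand_C]
  have h5 : (PowerSeries.mk fun c => q ^ (c / 1)) * PowerSeries.mk (eulerCoeff q) *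
      ((1 - C q * X) * E) = 1 := by
    linear_combination E * mk (eulerCoeff q) * h2 + hE1
  rw [h4, ← map_mul, eq_comm, PowerSeries.eq_inv_iff_mul_eq_one, quantumFactor_eq hq one_pos,
    ← map_mul, h5, map_one]
  · rw [constantCoeff_expand]
    intro h0
    have := congrArg constantCoeff hE1
    simp at h0
    simp [h0] at this

end Series

/-! ### Pairs sorted by the nullity of the first entry -/

section Rank
open Module LinearMap

theorem natCard_eq_sum_fiber {X Y : Type*} [Finite X] [Fintype Y] (f : X → Y) :
    Nat.card X = ∑ y, Nat.card {x // f x = y} := by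
  rw [← Nat.card_sigma, Nat.card_congr (Equiv.sigmaFiberEquiv f)]

theorem natCard_eq_mul_of_fiber {X Y : Type*} [Finite X] [Finite Y] (f : X → Y) (c : ℕ)
    (h : ∀ y, Nat.card {x // f x = y} = c) : Nat.card X = Nat.card Y * c := by
  have := Fintype.ofFinite Y
  rw [natCard_eq_sum_fiber f, Finset.sum_congr rfl fun y _ => h y, Finset.sum_const,
    Finset.card_univ, Nat.card_eq_fintype_card, smul_eq_mul]

variable {F : Type*} [Field F] [Fintype F]
variable {U V W : Type*} [AddCommGroup U] [Module F U] [Finite U] [AddCommGroup V] [Module F V]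
  [Finite V] [AddCommGroup W] [Module F W] [Finite W]

local notation "q" => (Fintype.card F : ℝ)

instance finite_linearMap : Finite (U →ₗ[F] V) := Finite.of_injective _ DFunLike.coe_injective

instance finite_linearEquiv : Finite (U ≃ₗ[F] V) := Finite.of_injective _ DFunLike.coe_injective

theorem natCard_linearMap :
    Nat.card (U →ₗ[F] V) = Fintype.card F ^ (finrank F U * finrank F V) := by
  rw [natCard_eq_pow_finrank (K := F), finrank_linearMap, Nat.card_eq_fintype_card]

theorem natCard_injective :
    (Nat.card {f : U →ₗ[F] V // Function.Injective f} : ℝ) =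
      ∏ k ∈ Finset.range (finrank F U), (q ^ finrank F V - q ^ k) := by
  have e : {f : U →ₗ[F] V // Function.Injective f} ≃
      {s : Fin (finrank F U) → V // LinearIndependent F s} :=
    (((finBasis F U).constr F).symm.toEquiv).subtypeEquiv fun f => by
      have h := (finBasis F U).linearIndependent
      change _ ↔ LinearIndependent F (f ∘ finBasis F U)
      constructor
      · intro hf
        exact h.map' f (LinearMap.ker_eq_bot.2 hf)
      · intro hf
        have hrepr (x : U) : f x =
            Finsupp.linearCombination F (f ∘ finBasis F U) ((finBasis F U).repr x) := by
          rw [← Finsupp.apply_linearCombination, Basis.linearCombination_repr]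
        intro x y hxy
        rw [hrepr x, hrepr y] at hxy
        exact (finBasis F U).repr.injective (hf hxy)
  rw [Nat.card_congr e]
  by_cases hk : finrank F U ≤ finrank F V
  · rw [card_linearIndependent hk, ← Fin.prod_univ_eq_prod_range
      (fun k => q ^ finrank F V - q ^ k)]
    push_cast
    refine Finset.prod_congr rfl fun i _ => ?_
    rw [Nat.cast_sub (Nat.pow_le_pow_right Fintype.card_pos (by omega))]
    push_cast
    rfl
  · rw [Finset.prod_eq_zero (Finset.mem_range.2 (not_le.1 hk)) (sub_self _)]
    have : IsEmpty {s : Fin (finrank F U) → V // LinearIndependent F s} :=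
      ⟨fun s => hk (by simpa using s.2.fintype_card_le_finrank)⟩
    simp

theorem natCard_surjective :
    (Nat.card {f : U →ₗ[F] V // Function.Surjective f} : ℝ) =
      ∏ k ∈ Finset.range (finrank F V), (q ^ finrank F U - q ^ k) := by
  have : Finite (Dual F U) := finite_linearMap
  have : Finite (Dual F V) := finite_linearMap
  have hbij : Function.Bijective (Dual.transpose (R := F) (M := U) (M' := V)) := by
    have hinj : Function.Injective (Dual.transpose (R := F) (M := U) (M' := V)) := by
      intro f g h
      ext x
      rw [← sub_eq_zero, ← forall_dual_apply_eq_zero_iff F]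
      intro φ
      rw [map_sub, sub_eq_zero]
      exact LinearMap.congr_fun (LinearMap.congr_fun h φ) x
    refine hinj.bijective_of_nat_card_le (le_of_eq ?_)
    rw [natCard_linearMap, natCard_linearMap, Subspace.dual_finrank_eq, Subspace.dual_finrank_eq,
      mul_comm]
  have e : {f : U →ₗ[F] V // Function.Surjective f} ≃
      {g : Dual F V →ₗ[F] Dual F U // Function.Injective g} :=
    (Equiv.ofBijective _ hbij).subtypeEquiv fun f => (dualMap_injective_iff (f := f)).symm
  rw [Nat.card_congr e, natCard_injective, Subspace.dual_finrank_eq, Subspace.dual_finrank_eq]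

theorem natCard_linearEquiv_self :
    (Nat.card (U ≃ₗ[F] U) : ℝ) = glOrder q (finrank F U) := by
  rw [glOrder, ← natCard_injective]
  congr 1
  refine Nat.card_congr (Equiv.ofBijective (fun e => ⟨e, e.injective⟩) ⟨?_, ?_⟩)
  · intro e e' h
    exact LinearEquiv.toLinearMap_injective (congrArg Subtype.val h)
  · rintro ⟨f, hf⟩
    exact ⟨LinearEquiv.ofInjectiveEndo f hf, by ext; rfl⟩

theorem natCard_comp_mkQ_eq (S : Submodule F V) (g : U →ₗ[F] V ⧸ S) :
    Nat.card {d : U →ₗ[F] V // S.mkQ ∘ₗ d = g} =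
      Fintype.card F ^ (finrank F U * finrank F S) := by
  obtain ⟨d₀, rfl⟩ : ∃ d₀, S.mkQ ∘ₗ d₀ = g :=
    Module.projective_lifting_property S.mkQ g S.mkQ_surjective
  rw [← natCard_linearMap]
  symm
  refine Nat.card_congr (Equiv.ofBijective
    (fun h => ⟨d₀ + S.subtype ∘ₗ h, ?_⟩) ⟨?_, ?_⟩)
  · ext; simp
  · intro h h' e
    ext x
    simpa using LinearMap.congr_fun (congrArg Subtype.val e) x
  · rintro ⟨d, hd⟩
    refine ⟨(d - d₀).codRestrict S fun x => ?_, ?_⟩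
    · have := LinearMap.congr_fun hd x
      simpa [Submodule.Quotient.eq] using this
    · ext x; simp

/-- The maps `d : U → V` whose range spans `V` together with a given subspace `S`. -/
theorem natCard_sup_range_eq_top (S : Submodule F V) :
    (Nat.card {d : U →ₗ[F] V // S ⊔ range d = ⊤} : ℝ) =
      (∏ k ∈ Finset.range (finrank F V - finrank F S), (q ^ finrank F U - q ^ k)) *
        q ^ (finrank F U * finrank F S) := by
  have : Finite (V ⧸ S) := Finite.of_surjective _ S.mkQ_surjective
  have key (d : U →ₗ[F] V) : Function.Surjective (S.mkQ ∘ₗ d) ↔ S ⊔ range d = ⊤ := by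
    rw [← range_eq_top, range_comp, Submodule.map_mkQ_eq_top]
  have h := natCard_eq_mul_of_fiber
    (fun d : {d : U →ₗ[F] V // S ⊔ range d = ⊤} =>
      (⟨S.mkQ ∘ₗ d.1, (key d.1).2 d.2⟩ : {g : U →ₗ[F] V ⧸ S // Function.Surjective g}))
    (Fintype.card F ^ (finrank F U * finrank F S)) (by
      rintro ⟨g, hg⟩
      rw [← natCard_comp_mkQ_eq S g]
      refine Nat.card_congr
        (Equiv.ofBijective (fun d => ⟨d.1.1, congrArg Subtype.val d.2⟩) ⟨?_, ?_⟩)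
      · intro d d' e
        exact Subtype.ext (Subtype.ext (Subtype.mk.inj e))
      · rintro ⟨d, rfl⟩
        exact ⟨⟨⟨d, (key d).1 hg⟩, rfl⟩, rfl⟩)
  rw [h]
  push_cast
  rw [natCard_surjective, Submodule.finrank_quotient]

/-- The pairs of endomorphisms `(A, B)` of `V` with `A B = ζ B A`. -/
abbrev TwistedPair (ζ : F) (V : Type*) [AddCommGroup V] [Module F V] : Type _ :=
  {p : End F V × End F V // p.1 * p.2 = ζ • (p.2 * p.1)}

instance (ζ : F) : Finite (TwistedPair ζ V) :=
  have : Finite (End F V) := finite_linearMap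
  inferInstance

/-- The pairs `(A, B)` with `A B = ζ B A` such that the kernel of `A` has dimension `a`. -/
abbrev NullityPair (ζ : F) (V : Type*) [AddCommGroup V] [Module F V] (a : ℕ) : Type _ :=
  {p : TwistedPair ζ V // finrank F (ker p.1.1) = a}

/-- A factorization of a pair `(A, B)` with `A B = ζ B A` through `U`: `A = ι ∘ π`, and `B'` is the
endomorphism of `U` that `B` induces. -/
abbrev Factorization (ζ : F) (U V : Type*) [AddCommGroup U] [Module F U] [AddCommGroup V]
    [Module F V] : Type _ :=
  {x : ((U →ₗ[F] V) × (V →ₗ[F] U)) × (End F V × End F U) //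
    (Function.Injective x.1.1 ∧ Function.Surjective x.1.2) ∧
      x.2.1 ∘ₗ x.1.1 = x.1.1 ∘ₗ x.2.2 ∧ x.1.2 ∘ₗ x.2.1 = ζ • (x.2.2 ∘ₗ x.1.2)}

instance (ζ : F) : Finite (Factorization ζ U V) :=
  have : Finite (End F V) := finite_linearMap
  have : Finite (End F U) := finite_linearMap
  inferInstance

/-- The endomorphisms `B` of `V` that are compatible with `ι`, `π` and a given pair `(π ∘ ι, B')` on
`U` form a torsor under `Hom(coker ι, ker π)`. -/
theorem natCard_compatible_end (ζ : F) (ι : U →ₗ[F] V) (π : V →ₗ[F] U) (hι : Function.Injective ι)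
    (hπ : Function.Surjective π) (B' : End F U) (h : π ∘ₗ ι ∘ₗ B' = ζ • (B' ∘ₗ π ∘ₗ ι)) :
    Nat.card {B : End F V // B ∘ₗ ι = ι ∘ₗ B' ∧ π ∘ₗ B = ζ • (B' ∘ₗ π)} =
      Fintype.card F ^ ((finrank F V - finrank F U) * (finrank F V - finrank F U)) := by
  have : Finite (V ⧸ range ι) := Finite.of_surjective _ (range ι).mkQ_surjective
  obtain ⟨ρ, hρ⟩ := ι.exists_leftInverse_of_injective (LinearMap.ker_eq_bot.2 hι)
  obtain ⟨σ, hσ⟩ := π.exists_rightInverse_of_surjective (LinearMap.range_eq_top.2 hπ)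
  have hρ' (x) : ρ (ι x) = x := LinearMap.congr_fun hρ x
  have hσ' (x) : π (σ x) = x := LinearMap.congr_fun hσ x
  have h' (x) : π (ι (B' x)) = ζ • B' (π (ι x)) := LinearMap.congr_fun h x
  set B₀ : End F V := ι ∘ₗ B' ∘ₗ ρ + ζ • (σ ∘ₗ B' ∘ₗ π ∘ₗ (LinearMap.id - ι ∘ₗ ρ)) with hB₀
  have hB₀ι (x) : B₀ (ι x) = ι (B' x) := by simp [hB₀, hρ']
  have hπB₀ (x) : π (B₀ x) = ζ • B' (π x) := by
    simp [hB₀, hσ', h', smul_sub]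
  have hmk (x) : (Submodule.Quotient.mk (ι x) : V ⧸ range ι) = 0 :=
    (Submodule.Quotient.mk_eq_zero _).2 ⟨x, rfl⟩
  have hcoker : finrank F (V ⧸ range ι) = finrank F V - finrank F U := by
    rw [Submodule.finrank_quotient, finrank_range_of_inj hι]
  have hker : finrank F (ker π) = finrank F V - finrank F U := by
    have := finrank_range_add_finrank_ker π
    rw [LinearMap.range_eq_top.2 hπ, finrank_top] at this
    omega
  have hcard := natCard_linearMap (F := F) (U := V ⧸ range ι) (V := ker π)
  rw [hcoker, hker] at hcard
  rw [← hcard]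
  symm
  refine Nat.card_congr (Equiv.ofBijective
    (fun D => ⟨B₀ + (ker π).subtype ∘ₗ D ∘ₗ (range ι).mkQ, ?_, ?_⟩) ⟨?_, ?_⟩)
  · ext x
    simp [hB₀ι, hmk]
  · ext x
    simp [hπB₀]
  · intro D D' e
    ext x
    simpa using LinearMap.congr_fun (congrArg Subtype.val e) x
  · rintro ⟨B, hB₁, hB₂⟩
    have h₁ (x) : B (ι x) = ι (B' x) := LinearMap.congr_fun hB₁ x
    have h₂ (x) : π (B x) = ζ • B' (π x) := LinearMap.congr_fun hB₂ x
    refine ⟨(range ι).liftQ ((B - B₀).codRestrict (ker π) fun x => ?_) ?_, ?_⟩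
    · simp [h₂, hπB₀]
    · rintro _ ⟨x, rfl⟩
      simp [h₁, hB₀ι]
    · ext x
      simp

/-- The surjections `π : V → U` with a prescribed restriction `A'` along `ι : U → V`. -/
theorem natCard_surjective_extension (ι : U →ₗ[F] V) (hι : Function.Injective ι) (A' : End F U) :
    (Nat.card {π : V →ₗ[F] U // Function.Surjective π ∧ π ∘ₗ ι = A'} : ℝ) =
      (∏ k ∈ Finset.range (finrank F (ker A')), (q ^ (finrank F V - finrank F U) - q ^ k)) *
        q ^ ((finrank F V - finrank F U) * (finrank F U - finrank F (ker A'))) := by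
  have : Finite (V ⧸ range ι) := Finite.of_surjective _ (range ι).mkQ_surjective
  obtain ⟨ρ, hρ⟩ := ι.exists_leftInverse_of_injective (LinearMap.ker_eq_bot.2 hι)
  have hρ' (x) : ρ (ι x) = x := LinearMap.congr_fun hρ x
  have hmk (x) : (Submodule.Quotient.mk (ι x) : V ⧸ range ι) = 0 :=
    (Submodule.Quotient.mk_eq_zero _).2 ⟨x, rfl⟩
  have hcoker : finrank F (V ⧸ range ι) = finrank F V - finrank F U := by
    rw [Submodule.finrank_quotient, finrank_range_of_inj hι]
  have hrk := finrank_range_add_finrank_ker A'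
  have hcard := natCard_sup_range_eq_top (U := V ⧸ range ι) (range A')
  rw [hcoker, show finrank F U - finrank F (range A') = finrank F (ker A') by omega,
    show finrank F (range A') = finrank F U - finrank F (ker A') by omega] at hcard
  rw [← hcard]
  have hrange (d : V ⧸ range ι →ₗ[F] U) :
      range (A' ∘ₗ ρ + d ∘ₗ (range ι).mkQ) = range A' ⊔ range d := by
    apply le_antisymm
    · rintro _ ⟨x, rfl⟩
      exact Submodule.add_mem_sup ⟨_, rfl⟩ ⟨_, rfl⟩
    · refine sup_le ?_ ?_
      · rintro _ ⟨x, rfl⟩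
        exact ⟨ι x, by simp [hρ', hmk]⟩
      · rintro _ ⟨y, rfl⟩
        obtain ⟨x, rfl⟩ := (range ι).mkQ_surjective y
        refine ⟨x - ι (ρ x), ?_⟩
        simp [hρ', hmk]
  congr 1
  symm
  refine Nat.card_congr (Equiv.ofBijective
    (fun d => ⟨A' ∘ₗ ρ + d.1 ∘ₗ (range ι).mkQ, ?_, ?_⟩) ⟨?_, ?_⟩)
  · rw [← range_eq_top, hrange, d.2]
  · ext x
    simp [hρ', hmk]
  · intro d d' e
    apply Subtype.ext
    ext x
    simpa using LinearMap.congr_fun (Subtype.mk.inj e) x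
  · rintro ⟨π, hπ, rfl⟩
    have hd : π ∘ₗ ι ∘ₗ ρ + (range ι).liftQ (π - π ∘ₗ ι ∘ₗ ρ) (by
        rintro _ ⟨x, rfl⟩
        simp [hρ']) ∘ₗ (range ι).mkQ = π := by
      ext x
      simp
    refine ⟨⟨_, ?_⟩, Subtype.ext hd⟩
    rw [← hrange]
    rw [← range_eq_top, ← hd] at hπ
    exact hπ

/-- Counting factorizations by `ι` and the pair `(π ∘ ι, B')` induced on `U`. -/
theorem natCard_factorization (ζ : F) :
    (Nat.card (Factorization ζ U V) : ℝ) =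
      (∏ k ∈ Finset.range (finrank F U), (q ^ finrank F V - q ^ k)) *
        q ^ ((finrank F V - finrank F U) * (finrank F V - finrank F U)) *
        ∑ᶠ p : TwistedPair ζ U,
          (∏ k ∈ Finset.range (finrank F (ker p.1.1)),
            (q ^ (finrank F V - finrank F U) - q ^ k)) *
          q ^ ((finrank F V - finrank F U) * (finrank F U - finrank F (ker p.1.1))) := by
  have : Fintype {ι : U →ₗ[F] V // Function.Injective ι} := Fintype.ofFinite _
  have : Fintype (TwistedPair ζ U) := Fintype.ofFinite _
  have induced (x : Factorization ζ U V) :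
      (x.1.1.2 ∘ₗ x.1.1.1) * x.1.2.2 = ζ • (x.1.2.2 * (x.1.1.2 ∘ₗ x.1.1.1)) := by
    ext v
    have h₁ := LinearMap.congr_fun x.2.2.1 v
    have h₂ := LinearMap.congr_fun x.2.2.2 (x.1.1.1 v)
    simp only [LinearMap.comp_apply, LinearMap.smul_apply] at h₁ h₂
    simp [← h₁, h₂]
  set f : Factorization ζ U V → {ι : U →ₗ[F] V // Function.Injective ι} × TwistedPair ζ U :=
    fun x => (⟨x.1.1.1, x.2.1.1⟩, ⟨(x.1.1.2 ∘ₗ x.1.1.1, x.1.2.2), induced x⟩) with hf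
  have hfiber (y : {ι : U →ₗ[F] V // Function.Injective ι} × TwistedPair ζ U) :
      Nat.card {x // f x = y} =
        Nat.card {π : V →ₗ[F] U // Function.Surjective π ∧ π ∘ₗ y.1.1 = y.2.1.1} *
          Fintype.card F ^ ((finrank F V - finrank F U) * (finrank F V - finrank F U)) := by
    obtain ⟨⟨ι, hι⟩, ⟨⟨A', B'⟩, hp⟩⟩ := y
    have hmem (x : {x // f x = (⟨ι, hι⟩, ⟨(A', B'), hp⟩)}) :
        Function.Surjective x.1.1.1.2 ∧ x.1.1.1.2 ∘ₗ ι = A' := by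
      obtain ⟨x, hx⟩ := x
      obtain ⟨h₁, h₂⟩ := Prod.ext_iff.1 hx
      have h₁' := Subtype.mk.inj h₁
      have h₂' := congrArg Prod.fst (Subtype.mk.inj h₂)
      simp only at h₁' h₂'
      refine ⟨x.2.1.2, Eq.trans ?_ h₂'⟩
      rw [h₁']
    refine natCard_eq_mul_of_fiber (fun x => ⟨x.1.1.1.2, hmem x⟩) _ ?_
    rintro ⟨π, hπ, hA'⟩
    simp only at hA'
    subst hA'
    rw [← natCard_compatible_end ζ ι π hι hπ B' hp]
    symm
    refine Nat.card_congr (Equiv.ofBijective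
      (fun B => ⟨⟨⟨((ι, π), (B.1, B')), ⟨hι, hπ⟩, B.2⟩, rfl⟩, rfl⟩) ⟨?_, ?_⟩)
    · intro B B' e
      simp only [Subtype.mk.injEq, Prod.mk.injEq, true_and, and_true] at e
      exact Subtype.ext e
    · rintro ⟨⟨⟨⟨⟨ι₁, π₁⟩, ⟨B, B₁⟩⟩, h₁, h₂⟩, hx⟩, hπ'⟩
      simp only [hf, Subtype.mk.injEq, Prod.mk.injEq] at hx hπ'
      have hπ₁ : π₁ = π := hπ'
      obtain ⟨rfl, -, rfl⟩ := hx
      subst hπ₁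
      exact ⟨⟨B, h₂⟩, rfl⟩
  rw [natCard_eq_sum_fiber f, Nat.cast_sum, finsum_eq_sum_of_fintype, Fintype.sum_prod_type]
  have hterm (ι : {ι : U →ₗ[F] V // Function.Injective ι}) (p : TwistedPair ζ U) :
      ((Nat.card {x // f x = (ι, p)} : ℕ) : ℝ) =
        q ^ ((finrank F V - finrank F U) * (finrank F V - finrank F U)) *
        ((∏ k ∈ Finset.range (finrank F (ker p.1.1)),
            (q ^ (finrank F V - finrank F U) - q ^ k)) *
          q ^ ((finrank F V - finrank F U) * (finrank F U - finrank F (ker p.1.1)))) := by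
    rw [hfiber, Nat.cast_mul, natCard_surjective_extension _ ι.2, mul_comm]
    push_cast
    rfl
  simp only [hterm, ← Finset.mul_sum]
  rw [Finset.sum_const, Finset.card_univ, nsmul_eq_mul, ← natCard_injective (F := F),
    Nat.card_eq_fintype_card]
  ring

omit [Fintype F] in
/-- Every pair `(A, B)` with `rank A = dim U` has exactly `|GL(U)|` factorizations through `U`. -/
theorem natCard_factorization_eq_mul {ζ : F} (hζ : ζ ≠ 0) {a : ℕ}
    (ha : finrank F V = finrank F U + a) :
    Nat.card (Factorization ζ U V) = Nat.card (NullityPair ζ V a) * Nat.card (U ≃ₗ[F] U) := by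
  have compat (x : Factorization ζ U V) :
      (x.1.1.1 ∘ₗ x.1.1.2) * x.1.2.1 = ζ • (x.1.2.1 * (x.1.1.1 ∘ₗ x.1.1.2)) := by
    ext v
    have h₁ := LinearMap.congr_fun x.2.2.1 (x.1.1.2 v)
    have h₂ := LinearMap.congr_fun x.2.2.2 v
    simp only [LinearMap.comp_apply, LinearMap.smul_apply] at h₁ h₂
    simp [h₁, h₂]
  have nullity (x : Factorization ζ U V) :
      finrank F (ker (x.1.1.1 ∘ₗ x.1.1.2)) = a := by
    rw [LinearMap.ker_comp_of_ker_eq_bot _ (LinearMap.ker_eq_bot.2 x.2.1.1)]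
    have := finrank_range_add_finrank_ker x.1.1.2
    rw [LinearMap.range_eq_top.2 x.2.1.2, finrank_top] at this
    omega
  set f : Factorization ζ U V → NullityPair ζ V a :=
    fun x => ⟨⟨(x.1.1.1 ∘ₗ x.1.1.2, x.1.2.1), compat x⟩, nullity x⟩ with hf
  refine natCard_eq_mul_of_fiber f _ ?_
  rintro ⟨⟨⟨A, B⟩, hAB⟩, hA⟩
  simp only at hA hAB
  have hAB' (v) : A (B v) = ζ • B (A v) := LinearMap.congr_fun hAB v
  obtain ⟨e⟩ : Nonempty (U ≃ₗ[F] range A) := by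
    refine ⟨LinearEquiv.ofFinrankEq _ _ ?_⟩
    have := finrank_range_add_finrank_ker A
    omega
  have hB : ∀ v ∈ range A, B v ∈ range A := by
    rintro _ ⟨v, rfl⟩
    exact ⟨ζ⁻¹ • B v, by rw [map_smul, hAB', inv_smul_smul₀ hζ]⟩
  set ι₀ : U →ₗ[F] V := (range A).subtype ∘ₗ e with hι₀
  set π₀ : V →ₗ[F] U := e.symm ∘ₗ A.rangeRestrict with hπ₀
  set B₀ : End F U := e.symm ∘ₗ B.restrict hB ∘ₗ e with hB₀
  have hι₀inj : Function.Injective ι₀ := Subtype.val_injective.comp e.injective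
  have hπ₀surj : Function.Surjective π₀ := e.symm.surjective.comp A.surjective_rangeRestrict
  have hA₀ (v) : ι₀ (π₀ v) = A v := by simp [hι₀, hπ₀]
  have hBι₀ (u) : B (ι₀ u) = ι₀ (B₀ u) := by simp [hι₀, hB₀]
  have hπ₀B (v) : π₀ (B v) = ζ • B₀ (π₀ v) := by
    apply hι₀inj
    rw [map_smul, ← hBι₀, hA₀, hA₀, hAB']
  symm
  refine Nat.card_congr (Equiv.ofBijective (fun g =>
    ⟨⟨((ι₀ ∘ₗ g, g.symm ∘ₗ π₀), (B, g.symm ∘ₗ B₀ ∘ₗ g)),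
      ⟨hι₀inj.comp g.injective, g.symm.surjective.comp hπ₀surj⟩, ?_, ?_⟩, ?_⟩) ⟨?_, ?_⟩)
  · ext u
    simp [hBι₀]
  · ext v
    simp [hπ₀B]
  · simp only [hf, Subtype.mk.injEq, Prod.mk.injEq, and_true]
    ext v
    simp [hA₀]
  · intro g g' h
    simp only [Subtype.mk.injEq, Prod.mk.injEq] at h
    ext u
    exact hι₀inj (LinearMap.congr_fun h.1.1 u)
  · rintro ⟨⟨⟨⟨ι, π⟩, ⟨B₁, B'⟩⟩, ⟨hι, hπ⟩, h₁, h₂⟩, hx⟩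
    simp only [hf, Subtype.mk.injEq, Prod.mk.injEq] at hx
    obtain ⟨hA₁, rfl⟩ := hx
    simp only at hι hπ h₁ h₂
    have hA₁' (v) : ι (π v) = ι₀ (π₀ v) := by
      rw [hA₀, ← hA₁]
      rfl
    obtain ⟨σ, hσ⟩ := π.exists_rightInverse_of_surjective (LinearMap.range_eq_top.2 hπ)
    have hσ' (x) : π (σ x) = x := LinearMap.congr_fun hσ x
    have hg (u) : ι₀ (π₀ (σ u)) = ι u := by rw [← hA₁', hσ']
    have hginj : Function.Injective (π₀ ∘ₗ σ) := by
      intro u u' h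
      apply hι
      rw [← hg, ← hg]
      exact congrArg ι₀ h
    set g : U ≃ₗ[F] U := LinearEquiv.ofInjectiveEndo (π₀ ∘ₗ σ) hginj with hgdef
    have hg' (u) : ι₀ (g u) = ι u := hg u
    refine ⟨g, ?_⟩
    simp only [Subtype.mk.injEq, Prod.mk.injEq, true_and]
    refine ⟨⟨?_, ?_⟩, ?_⟩
    · ext u
      exact hg' u
    · ext v
      apply hι
      rw [← hg', hA₁']
      simp
    · ext u
      apply hι
      have := LinearMap.congr_fun h₁ u
      simp only [LinearMap.comp_apply] at this
      rw [← this, ← hg', ← hg', hBι₀]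
      simp

/-- The number of pairs `(A, B)` on `Fⁿ` with `A B = ζ B A` and `dim ker A = a`, divided by the
order of the general linear group. -/
noncomputable def nullityRatio (ζ : F) (n a : ℕ) : ℝ :=
  Nat.card (NullityPair ζ (Fin n → F) a) / glOrder q n

theorem one_lt_card_cast : 1 < q := by exact_mod_cast Fintype.one_lt_card

theorem finsum_twistedPair_eq_sum (ζ : F) (n : ℕ) (g : ℕ → ℝ) :
    ∑ᶠ p : TwistedPair ζ (Fin n → F), g (finrank F (ker p.1.1)) =
      ∑ b ∈ Finset.range (n + 1), g b * Nat.card (NullityPair ζ (Fin n → F) b) := by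
  have : Fintype (TwistedPair ζ (Fin n → F)) := Fintype.ofFinite _
  rw [finsum_eq_sum_of_fintype, ← Finset.sum_fiberwise_of_maps_to (t := Finset.range (n + 1))
    (g := fun p : TwistedPair ζ (Fin n → F) => finrank F (ker p.1.1))]
  · refine Finset.sum_congr rfl fun b _ => ?_
    rw [Finset.sum_congr rfl fun p hp => by rw [(Finset.mem_filter.1 hp).2], Finset.sum_const,
      nsmul_eq_mul, mul_comm, Nat.card_eq_fintype_card, Fintype.card_subtype]
  · intro p _
    have := Submodule.finrank_le (ker p.1.1)
    rw [finrank_fin_fun] at this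
    simp only [Finset.mem_range]
    omega

omit [Fintype F] in
theorem natCard_nullityPair_eq_zero (ζ : F) {n a : ℕ} (h : n < a) :
    Nat.card (NullityPair ζ (Fin n → F) a) = 0 := by
  have : IsEmpty (NullityPair ζ (Fin n → F) a) := by
    refine ⟨fun p => ?_⟩
    have := Submodule.finrank_le (ker p.1.1.1)
    rw [finrank_fin_fun, p.2] at this
    omega
  exact Nat.card_of_isEmpty

theorem nullityRatio_eq_zero (ζ : F) {n a : ℕ} (h : n < a) : nullityRatio ζ n a = 0 := by
  rw [nullityRatio, natCard_nullityPair_eq_zero ζ h, Nat.cast_zero, zero_div]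

/-- The pairs with `dim ker A = a` factor through a space of dimension `n - a`. After division by
the orders of the general linear groups, the number of ways to extend a pair with nullity `b` depends
only on `a - b`. -/
theorem nullityRatio_recursion {ζ : F} (hζ : ζ ≠ 0) {n a : ℕ} (h : a ≤ n) :
    nullityRatio ζ n a =
      ∑ b ∈ Finset.range (a + 1), eulerCoeff q (a - b) * nullityRatio ζ (n - a) b := by
  obtain ⟨r, rfl⟩ := Nat.exists_eq_add_of_le' h
  have hq := one_lt_card_cast (F := F)
  have hq0 : q ≠ 0 := by positivity
  have h1 := natCard_factorization_eq_mul (U := Fin r → F) (V := Fin (r + a) → F) hζ (a := a)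
    (by simp)
  have h2 := natCard_factorization (U := Fin r → F) (V := Fin (r + a) → F) ζ
  rw [h1, Nat.cast_mul, natCard_linearEquiv_self] at h2
  simp only [finrank_fin_fun, Nat.add_sub_cancel_left] at h2
  rw [finsum_twistedPair_eq_sum ζ r fun b =>
    (∏ k ∈ Finset.range b, (q ^ a - q ^ k)) * q ^ (a * (r - b))] at h2
  -- Only `b ≤ min a r` contributes: the product vanishes for `a < b`, the count for `r < b`.
  have h3 : ∑ b ∈ Finset.range (r + 1), (∏ k ∈ Finset.range b, (q ^ a - q ^ k)) *
      q ^ (a * (r - b)) * Nat.card (NullityPair ζ (Fin r → F) b) =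
      ∑ b ∈ Finset.range (a + 1), (∏ k ∈ Finset.range b, (q ^ a - q ^ k)) *
      q ^ (a * (r - b)) * Nat.card (NullityPair ζ (Fin r → F) b) := by
    trans ∑ b ∈ Finset.range (a + r + 1), (∏ k ∈ Finset.range b, (q ^ a - q ^ k)) *
      q ^ (a * (r - b)) * Nat.card (NullityPair ζ (Fin r → F) b)
    · refine Finset.sum_subset (Finset.range_mono (by omega)) fun b _ hb => ?_
      rw [natCard_nullityPair_eq_zero ζ (by simpa using hb), Nat.cast_zero, mul_zero]
    · refine (Finset.sum_subset (Finset.range_mono (by omega)) fun b _ hb => ?_).symm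
      rw [Finset.prod_eq_zero (i := a) (by simpa using hb) (sub_self _), zero_mul, zero_mul]
  rw [h3] at h2
  have hra := (glOrder_pos hq (r + a)).ne'
  have hr := (glOrder_pos hq r).ne'
  rw [Nat.add_sub_cancel, nullityRatio, div_eq_iff hra, ← mul_left_inj' hr, h2, glOrder_add q r a,
    Finset.mul_sum, Finset.sum_mul, Finset.sum_mul]
  refine Finset.sum_congr rfl fun b hb => ?_
  rw [nullityRatio]
  by_cases hbr : b ≤ r
  · obtain ⟨c, rfl⟩ := Nat.exists_eq_add_of_le (Nat.lt_succ_iff.1 (Finset.mem_range.1 hb))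
    obtain ⟨d, rfl⟩ := Nat.exists_eq_add_of_le hbr
    have hc := (glOrder_pos hq c).ne'
    rw [Nat.add_sub_cancel_left, Nat.add_sub_cancel_left, glOrder_add q b c, eulerCoeff]
    field_simp
    ring
  · rw [natCard_nullityPair_eq_zero ζ (not_le.1 hbr)]
    simp

end Rank

/-! ### Cancellation of finite modules -/

section Cancellation
open Module LinearMap

universe u
variable {R : Type*} [CommRing R]

/-- The number of injective homomorphisms out of a finite module is determined by the numbers of all
homomorphisms out of its quotients: a homomorphism with kernel `K` is an injection of the quotient
by `K`. -/
theorem natCard_injective_eq_of_natCard_linearMap_eq {M N N' : Type u} [AddCommGroup M] [Module R M]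
    [Finite M] [AddCommGroup N] [Module R N] [Finite N] [AddCommGroup N'] [Module R N'] [Finite N']
    (h : ∀ (X : Type u) [AddCommGroup X] [Module R X] [Finite X],
      Nat.card (X →ₗ[R] N) = Nat.card (X →ₗ[R] N')) :
    Nat.card {f : M →ₗ[R] N // Function.Injective f} =
      Nat.card {f : M →ₗ[R] N' // Function.Injective f} := by
  induction hM : Nat.card M using Nat.strong_induction_on generalizing M with
  | _ k ih =>
  subst hM
  have fin (P : Type u) [AddCommGroup P] [Module R P] [Finite P] : Finite (M →ₗ[R] P) :=
    Finite.of_injective _ DFunLike.coe_injective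
  have : Finite (Submodule R M) := Finite.of_injective _ SetLike.coe_injective
  have : Fintype (Submodule R M) := Fintype.ofFinite _
  have fiber (P : Type u) [AddCommGroup P] [Module R P] [Finite P] (K : Submodule R M) :
      Nat.card {f : M →ₗ[R] P // ker f = K} =
        Nat.card {f : M ⧸ K →ₗ[R] P // Function.Injective f} := by
    symm
    refine Nat.card_congr (Equiv.ofBijective (fun f => ⟨f.1 ∘ₗ K.mkQ, ?_⟩) ⟨?_, ?_⟩)
    · rw [ker_comp_of_ker_eq_bot _ (ker_eq_bot.2 f.2), Submodule.ker_mkQ]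
    · intro f g e
      apply Subtype.ext
      ext x
      exact LinearMap.congr_fun (Subtype.mk.inj e) x
    · rintro ⟨f, rfl⟩
      refine ⟨⟨(ker f).liftQ f le_rfl, ?_⟩, ?_⟩
      · rw [← ker_eq_bot]
        exact Submodule.ker_liftQ_eq_bot' _ _ rfl
      · ext x
        simp
  have bot (P : Type u) [AddCommGroup P] [Module R P] [Finite P] :
      Nat.card {f : M →ₗ[R] P // ker f = ⊥} = Nat.card {f : M →ₗ[R] P // Function.Injective f} :=
    Nat.card_congr (Equiv.subtypeEquivRight fun f => ker_eq_bot)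
  have hN := natCard_eq_sum_fiber (fun f : M →ₗ[R] N => ker f)
  have hN' := natCard_eq_sum_fiber (fun f : M →ₗ[R] N' => ker f)
  rw [← Finset.add_sum_erase _ _ (Finset.mem_univ ⊥), bot] at hN hN'
  have hrest : ∑ K ∈ Finset.univ.erase (⊥ : Submodule R M), Nat.card {f : M →ₗ[R] N // ker f = K} =
      ∑ K ∈ Finset.univ.erase (⊥ : Submodule R M), Nat.card {f : M →ₗ[R] N' // ker f = K} := by
    refine Finset.sum_congr rfl fun K hK => ?_
    have : Finite (M ⧸ K) := Finite.of_surjective _ K.mkQ_surjective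
    rw [fiber, fiber]
    refine ih _ ?_ rfl
    have hcard := Submodule.card_eq_card_quotient_mul_card K
    have hK1 : 1 < Nat.card K :=
      Finite.one_lt_card_iff_nontrivial.2 (K.nontrivial_iff_ne_bot.2 (Finset.ne_of_mem_erase hK))
    have : 0 < Nat.card (M ⧸ K) := Nat.card_pos
    nlinarith
  have := h M
  omega

/-- Finite modules can be cancelled from direct sums: homomorphism counts are multiplicative, and
they determine a finite module up to isomorphism. -/
theorem nonempty_linearEquiv_of_prod {P N N' : Type u} [AddCommGroup P] [Module R P] [Finite P]
    [AddCommGroup N] [Module R N] [Finite N] [AddCommGroup N'] [Module R N'] [Finite N']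
    (e : (P × N) ≃ₗ[R] P × N') : Nonempty (N ≃ₗ[R] N') := by
  have hom (X : Type u) [AddCommGroup X] [Module R X] [Finite X] :
      Nat.card (X →ₗ[R] N) = Nat.card (X →ₗ[R] N') := by
    have : Finite (X →ₗ[R] P) := Finite.of_injective _ DFunLike.coe_injective
    have hpos : 0 < Nat.card (X →ₗ[R] P) := Nat.card_pos
    apply Nat.eq_of_mul_eq_mul_left hpos
    rw [← Nat.card_prod, ← Nat.card_prod, Nat.card_congr (prodEquiv ℕ).toEquiv,
      Nat.card_congr (prodEquiv ℕ).toEquiv]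
    exact Nat.card_congr ((LinearEquiv.refl R X).arrowCongr e).toEquiv
  have inj : Nonempty {f : N →ₗ[R] N' // Function.Injective f} := by
    have : Finite (N →ₗ[R] N') := Finite.of_injective _ DFunLike.coe_injective
    have : Finite (N →ₗ[R] N) := Finite.of_injective _ DFunLike.coe_injective
    have : Nonempty {f : N →ₗ[R] N // Function.Injective f} := ⟨⟨.id, fun _ _ h => h⟩⟩
    rw [← Finite.card_pos_iff, ← natCard_injective_eq_of_natCard_linearMap_eq hom]
    exact Nat.card_pos
  obtain ⟨f, hf⟩ := inj
  have hcard : Nat.card N = Nat.card N' := by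
    have hP : 0 < Nat.card P := Nat.card_pos
    apply Nat.eq_of_mul_eq_mul_left hP
    rw [← Nat.card_prod, ← Nat.card_prod, Nat.card_congr e.toEquiv]
  exact ⟨LinearEquiv.ofBijective f (hf.bijective_of_nat_card_le hcard.ge)⟩

end Cancellation

/-! ### Similarity of endomorphisms -/

section Similarity
open Module LinearMap

variable {F : Type*} [Field F]
variable {U V W : Type*} [AddCommGroup U] [Module F U] [AddCommGroup V] [Module F V]
  [AddCommGroup W] [Module F W]

/-- The linear equivalences that intertwine two endomorphisms. -/
abbrev Intertwiner (B : End F U) (C : End F V) : Type _ :=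
  {e : U ≃ₗ[F] V // ∀ u, e (B u) = C (e u)}

/-- Similarity of endomorphisms of possibly different spaces. -/
def Similar (B : End F U) (C : End F V) : Prop := Nonempty (Intertwiner B C)

theorem Similar.refl (B : End F U) : Similar B B := ⟨⟨.refl F U, fun _ => rfl⟩⟩

theorem Similar.symm {B : End F U} {C : End F V} (h : Similar B C) : Similar C B := by
  obtain ⟨e, he⟩ := h
  refine ⟨⟨e.symm, fun v => e.injective ?_⟩⟩
  rw [he]
  simp

theorem Similar.trans {B : End F U} {C : End F V} {D : End F W} (h : Similar B C)
    (h' : Similar C D) : Similar B D := by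
  obtain ⟨e, he⟩ := h
  obtain ⟨e', he'⟩ := h'
  exact ⟨⟨e.trans e', fun u => by simp [he, he']⟩⟩

theorem Similar.smul {B : End F U} {C : End F V} (h : Similar B C) (ζ : F) :
    Similar (ζ • B) (ζ • C) := by
  obtain ⟨e, he⟩ := h
  exact ⟨⟨e, fun u => by simp [he]⟩⟩

theorem Similar.prodMap {B : End F U} {C : End F V} {C' : End F W} {U' : Type*}
    [AddCommGroup U'] [Module F U'] {D : End F U'} (h : Similar B D) (h' : Similar C C') :
    Similar (B.prodMap C) (D.prodMap C') := by
  obtain ⟨e, he⟩ := h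
  obtain ⟨e', he'⟩ := h'
  exact ⟨⟨e.prodCongr e', fun u => by simp [he, he']⟩⟩

theorem Similar.minpoly_eq {B : End F U} {C : End F V} (h : Similar B C) :
    minpoly F B = minpoly F C := by
  obtain ⟨e, he⟩ := h
  have : e.conjAlgEquiv F B = C := by
    ext v
    simp [he]
  rw [← this]
  exact (minpoly.algEquiv_eq (e.conjAlgEquiv F) B).symm

theorem natCard_intertwiner_right {B : End F U} {C : End F V} (h : Similar B C) :
    Nat.card (Intertwiner B C) = Nat.card (Intertwiner B B) := by
  obtain ⟨e, he⟩ := h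
  symm
  refine Nat.card_congr (Equiv.ofBijective (fun z => ⟨z.1.trans e, fun u => ?_⟩) ⟨?_, ?_⟩)
  · simp [z.2, he]
  · intro z z' h
    ext u
    simpa using LinearEquiv.congr_fun (Subtype.mk.inj h) u
  · rintro ⟨g, hg⟩
    refine ⟨⟨g.trans e.symm, fun u => e.injective ?_⟩, ?_⟩
    · rw [he]
      simp [hg]
    · ext u
      simp

theorem natCard_intertwiner_left {B : End F U} {C : End F V} (h : Similar B C) :
    Nat.card (Intertwiner B C) = Nat.card (Intertwiner C C) := by
  rw [← natCard_intertwiner_right h.symm]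
  refine Nat.card_congr ⟨fun z => ⟨z.1.symm, fun v => z.1.injective ?_⟩,
    fun z => ⟨z.1.symm, fun v => z.1.injective ?_⟩, fun z => rfl, fun z => rfl⟩
  · rw [z.2]
    simp
  · rw [z.2]
    simp

end Similarity

section SimilarCancel
open Module LinearMap
universe u
variable {F : Type*} [Field F]
variable {P U V : Type u} [AddCommGroup P] [Module F P] [AddCommGroup U] [Module F U]
  [AddCommGroup V] [Module F V]

theorem similar_iff_nonempty_aeval (B : End F U) (C : End F V) :
    Similar B C ↔ Nonempty (AEval' B ≃ₗ[Polynomial F] AEval' C) := by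
  constructor
  · rintro ⟨e, he⟩
    refine ⟨LinearEquiv.ofAEval B (e.trans (AEval'.of C)) fun u => ?_⟩
    rw [LinearEquiv.trans_apply, LinearEquiv.trans_apply, AEval'.X_smul_of, ← he]
    rfl
  · rintro ⟨e⟩
    refine ⟨⟨(AEval'.of B).trans ((e.restrictScalars F).trans (AEval'.of C).symm), fun u => ?_⟩⟩
    apply (AEval'.of C).injective
    rw [← AEval'.X_smul_of]
    simp [← AEval'.X_smul_of]

theorem Similar.cancel_left [Finite P] [Finite U] [Finite V] {D : End F P} {B : End F U}
    {C : End F V} (h : Similar (D.prodMap B) (D.prodMap C)) : Similar B C := by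
  have prodEquiv {U : Type u} [AddCommGroup U] [Module F U] (B : End F U) :
      Nonempty (AEval' (D.prodMap B) ≃ₗ[Polynomial F] AEval' D × AEval' B) := by
    refine ⟨LinearEquiv.ofAEval _ ((AEval'.of D).prodCongr (AEval'.of B)) fun x => ?_⟩
    ext
    · exact (AEval'.X_smul_of D x.1).symm
    · exact (AEval'.X_smul_of B x.2).symm
  obtain ⟨e⟩ := (similar_iff_nonempty_aeval _ _).1 h
  obtain ⟨e₁⟩ := prodEquiv B
  obtain ⟨e₂⟩ := prodEquiv C
  have : Finite (AEval' D) := inferInstanceAs (Finite P)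
  have : Finite (AEval' B) := inferInstanceAs (Finite U)
  have : Finite (AEval' C) := inferInstanceAs (Finite V)
  exact (similar_iff_nonempty_aeval _ _).2
    (nonempty_linearEquiv_of_prod (e₁.symm.trans (e.trans e₂)))

end SimilarCancel

/-! ### Splitting off a cyclic summand -/

section Cyclic
open Module LinearMap Polynomial

variable {F : Type*} [Field F] {V W : Type*} [AddCommGroup V] [Module F V] [AddCommGroup W]
  [Module F W]

/-- Multiplication by the root on `F[X] / (f)`: the endomorphism with companion matrix of `f`. -/
noncomputable def rootMul (f : F[X]) : End F (AdjoinRoot f) :=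
  Algebra.lmul F (AdjoinRoot f) (AdjoinRoot.root f)

theorem minpoly_rootMul {f : F[X]} (hf : f.Monic) : minpoly F (rootMul f) = f := by
  rw [rootMul, minpoly.algHom_eq _ Algebra.lmul_injective, AdjoinRoot.minpoly_root hf.ne_zero,
    hf.leadingCoeff, inv_one, C_1, mul_one]

theorem aeval_prodMap (B : End F V) (C : End F W) (p : F[X]) :
    aeval (B.prodMap C) p = (aeval B p).prodMap (aeval C p) := by
  have h := aeval_algHom_apply (prodMapAlgHom F V W) (B, C) p
  rw [aeval_prod_apply] at h
  exact h

theorem minpoly_dvd_minpoly_prodMap (B : End F V) (C : End F W) :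
    minpoly F C ∣ minpoly F (B.prodMap C) := by
  refine minpoly.dvd F C ?_
  have h := minpoly.aeval F (B.prodMap C)
  rw [aeval_prodMap] at h
  ext w
  exact congrArg Prod.snd (LinearMap.congr_fun h (0, w))

theorem minpoly_rootMul_prodMap {f : F[X]} (hf : f.Monic) {C : End F W} (h : minpoly F C ∣ f) :
    minpoly F ((rootMul f).prodMap C) = f := by
  have h0 : aeval ((rootMul f).prodMap C) f = 0 := by
    have h₁ : aeval (rootMul f) f = 0 := minpoly.dvd_iff.1 (minpoly_rootMul hf).dvd
    rw [aeval_prodMap, h₁, minpoly.dvd_iff.1 h]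
    rfl
  refine eq_of_monic_of_associated (minpoly.monic ⟨f, hf, h0⟩) hf (associated_of_dvd_dvd ?_ ?_)
  · exact minpoly.dvd F _ h0
  · refine (minpoly_rootMul hf).symm.dvd.trans (minpoly.dvd F _ ?_)
    have h := minpoly.aeval F ((rootMul f).prodMap C)
    rw [aeval_prodMap] at h
    ext w
    exact congrArg Prod.fst (LinearMap.congr_fun h (w, 0))

/-- The functional on `F[X] / (f)` that reads off the coefficient of `X ^ (deg f - 1)` defines a
nondegenerate trace form. -/
theorem exists_nondegenerate_functional {f : F[X]} (hf : f.Monic) :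
    ∃ φ : AdjoinRoot f →ₗ[F] F, ∀ x, (∀ y, φ (x * y) = 0) → x = 0 := by
  refine ⟨lcoeff F (f.natDegree - 1) ∘ₗ AdjoinRoot.modByMonicHom hf, fun x hx => ?_⟩
  by_contra hx0
  obtain ⟨p, rfl⟩ := AdjoinRoot.mk_surjective x
  set g := p %ₘ f with hg
  have hpg : AdjoinRoot.mk f p = AdjoinRoot.mk f g := by
    rw [← AdjoinRoot.mk_leftInverse hf (AdjoinRoot.mk f p), AdjoinRoot.modByMonicHom_mk]
  have hg0 : g ≠ 0 := by
    intro h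
    rw [hpg, h, map_zero] at hx0
    exact hx0 rfl
  have hf1 : f ≠ 1 := by
    intro h
    apply hg0
    rw [hg, h, modByMonic_one]
  have hdeg : g.natDegree < f.natDegree := natDegree_modByMonic_lt p hf hf1
  have hcoeff : (g * X ^ (f.natDegree - 1 - g.natDegree)).coeff (f.natDegree - 1) =
      g.leadingCoeff := by
    conv_lhs => rw [show f.natDegree - 1 = g.natDegree + (f.natDegree - 1 - g.natDegree) by omega]
    rw [Nat.add_sub_cancel_left, coeff_mul_X_pow, coeff_natDegree]
  have hmul : (g * X ^ (f.natDegree - 1 - g.natDegree)).natDegree = f.natDegree - 1 := by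
    rw [natDegree_mul_X_pow _ hg0]
    omega
  have := hx (AdjoinRoot.mk f (X ^ (f.natDegree - 1 - g.natDegree)))
  rw [hpg, ← map_mul, LinearMap.comp_apply, AdjoinRoot.modByMonicHom_mk,
    (modByMonic_eq_self_iff hf).2, lcoeff_apply, hcoeff, leadingCoeff_eq_zero] at this
  · exact hg0 this
  · refine degree_lt_degree ?_
    omega

/-- A cyclic subspace on which the minimal polynomial is attained splits off. Its complement is the
annihilator, with respect to a functional that extends a nondegenerate one, of the cyclic
subspace. -/
theorem exists_similar_rootMul_prodMap_restrict [FiniteDimensional F V] (B : End F V) :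
    ∃ (K : Submodule F V) (hK : ∀ v ∈ K, B v ∈ K),
      Similar B ((rootMul (minpoly F B)).prodMap (B.restrict hK)) := by
  set f := minpoly F B with hf
  have hmonic : f.Monic := minpoly.monic (Algebra.IsIntegral.isIntegral B)
  set Φ : AdjoinRoot f →ₐ[F] End F V :=
    Ideal.Quotient.liftₐ (Ideal.span {f}) (aeval B) fun p hp =>
      minpoly.dvd_iff.1 (Ideal.mem_span_singleton.1 hp) with hΦ
  have hΦmk (p : F[X]) : Φ (AdjoinRoot.mk f p) = aeval B p := rfl
  have hΦroot : Φ (AdjoinRoot.root f) = B := by rw [AdjoinRoot.root, hΦmk, aeval_X]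
  have hΦB (x : AdjoinRoot f) (v : V) : Φ (AdjoinRoot.root f * x) v = B (Φ x v) := by
    rw [map_mul, hΦroot]
    rfl
  obtain ⟨v, hv⟩ := exists_ker_toSpanSingleton_eq_annihilator (R := F[X]) (M := AEval' B)
  set ι : AdjoinRoot f →ₗ[F] V := (LinearMap.applyₗ ((AEval'.of B).symm v)) ∘ₗ Φ.toLinearMap with hι
  have hιapply (x) : ι x = Φ x ((AEval'.of B).symm v) := rfl
  have hιinj : Function.Injective ι := by
    rw [← LinearMap.ker_eq_bot, LinearMap.ker_eq_bot']
    intro x hx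
    obtain ⟨p, rfl⟩ := AdjoinRoot.mk_surjective x
    rw [hιapply, hΦmk] at hx
    have : p ∈ ker (toSpanSingleton F[X] (AEval' B) v) := by
      rw [mem_ker, toSpanSingleton_apply]
      apply (AEval'.of B).symm.injective
      rw [map_zero]
      exact hx
    rw [hv, AEval.annihilator_eq_ker_aeval, RingHom.mem_ker] at this
    rw [AdjoinRoot.mk_eq_zero]
    exact minpoly.dvd F B this
  obtain ⟨φ, hφ⟩ := exists_nondegenerate_functional hmonic
  obtain ⟨ρ, hρ⟩ := ι.exists_leftInverse_of_injective (LinearMap.ker_eq_bot.2 hιinj)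
  have hρ' (x) : ρ (ι x) = x := LinearMap.congr_fun hρ x
  -- The pairing `(w, x) ↦ φ (ρ (x • w))`, restricted to the cyclic subspace on the left,
  -- is the trace form.
  set θ : V →ₗ[F] Dual F (AdjoinRoot f) :=
    (LinearMap.compr₂ Φ.toLinearMap.flip (φ ∘ₗ ρ)) with hθ
  have hθapply (w x) : θ w x = φ (ρ (Φ x w)) := rfl
  have hθι (x y) : θ (ι x) y = φ (x * y) := by
    rw [hθapply, hιapply, mul_comm x y, ← hρ' (y * x), hιapply, map_mul]
    rfl
  have : FiniteDimensional F (AdjoinRoot f) := hmonic.finite_adjoinRoot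
  have hθιinj : Function.Injective (θ ∘ₗ ι) := by
    rw [← LinearMap.ker_eq_bot, LinearMap.ker_eq_bot']
    intro x hx
    exact hφ x fun y => by rw [← hθι]; exact LinearMap.congr_fun hx y
  have hθιsurj : Function.Surjective (θ ∘ₗ ι) :=
    (injective_iff_surjective_of_finrank_eq_finrank Subspace.dual_finrank_eq.symm).1 hθιinj
  have hK : ∀ w ∈ ker θ, B w ∈ ker θ := by
    intro w hw
    rw [mem_ker] at hw ⊢
    ext x
    have := LinearMap.congr_fun hw (x * AdjoinRoot.root f)
    rw [hθapply, map_mul, hΦroot] at this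
    exact this
  refine ⟨ker θ, hK, Similar.symm
    ⟨⟨LinearEquiv.ofBijective (ι.coprod (ker θ).subtype) ⟨?_, ?_⟩, ?_⟩⟩⟩
  · rw [← LinearMap.ker_eq_bot, LinearMap.ker_eq_bot']
    rintro ⟨x, k, hk⟩ h
    rw [mem_ker] at hk
    simp only [coprod_apply, Submodule.subtype_apply] at h
    have h₁ : (θ ∘ₗ ι) x = 0 := by
      have := congrArg θ h
      rwa [map_add, hk, add_zero, map_zero] at this
    have h₂ : x = 0 := hθιinj (by rw [h₁, map_zero])
    subst h₂
    rw [map_zero, zero_add] at h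
    subst h
    rfl
  · intro w
    obtain ⟨x, hx⟩ := hθιsurj (θ w)
    refine ⟨(x, ⟨w - ι x, ?_⟩), ?_⟩
    · rw [mem_ker, map_sub, ← hx, LinearMap.comp_apply, sub_self]
    · simp
  · rintro ⟨x, k⟩
    change ι (AdjoinRoot.root f * x) + B k = B (ι x + k)
    rw [map_add, hιapply, hιapply, hΦB]

theorem exists_similar_of_finrank_eq [FiniteDimensional F V] {n : ℕ} (h : finrank F V = n)
    (B : End F V) : ∃ C : End F (Fin n → F), Similar B C := by
  have e : V ≃ₗ[F] (Fin n → F) := LinearEquiv.ofFinrankEq _ _ (by simp [h])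
  exact ⟨e.conj B, ⟨e, fun v => by simp⟩⟩

/-- A rational canonical form step: every endomorphism is the direct sum of multiplication by the
root on `F[X] / (f)`, where `f` is the minimal polynomial, and a further endomorphism. -/
theorem exists_similar_rootMul_prodMap {n : ℕ} (B : End F (Fin n → F)) :
    ∃ C : End F (Fin (n - (minpoly F B).natDegree) → F),
      Similar B ((rootMul (minpoly F B)).prodMap C) := by
  obtain ⟨K, hK, h⟩ := exists_similar_rootMul_prodMap_restrict B
  have hmonic : (minpoly F B).Monic := minpoly.monic (Algebra.IsIntegral.isIntegral B)
  have := hmonic.finite_adjoinRoot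
  have := hmonic.free_adjoinRoot
  have hrank : finrank F (AdjoinRoot (minpoly F B)) = (minpoly F B).natDegree :=
    finrank_quotient_span_eq_natDegree
  obtain ⟨e, -⟩ := id h
  have hfin := e.finrank_eq
  rw [finrank_prod, hrank, finrank_fin_fun] at hfin
  obtain ⟨C, hC⟩ := exists_similar_of_finrank_eq (n := n - (minpoly F B).natDegree)
    (by omega) (B.restrict hK)
  exact ⟨C, h.trans ((Similar.refl _).prodMap hC)⟩

end Cyclic

/-! ### Polynomials with exponents in one residue class -/

section Homogeneous
open Module LinearMap Polynomial

variable {F : Type*} [Field F]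

/-- The polynomials `f` with `f(ζ X) = ζ ^ deg f * f(X)`, that is, with all exponents congruent to
the degree modulo the order of `ζ`. -/
def IsTwistHomogeneous (ζ : F) (f : F[X]) : Prop :=
  f.comp (C ζ * X) = C (ζ ^ f.natDegree) * f

theorem IsTwistHomogeneous.mul {ζ : F} {f g : F[X]} (hf : IsTwistHomogeneous ζ f)
    (hg : IsTwistHomogeneous ζ g) (hfm : f.Monic) (hgm : g.Monic) :
    IsTwistHomogeneous ζ (f * g) := by
  unfold IsTwistHomogeneous at *
  rw [mul_comp, hf, hg, hfm.natDegree_mul hgm, pow_add, C_mul]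
  ring

theorem IsTwistHomogeneous.of_mul_left {ζ : F} (hζ : ζ ≠ 0) {f g : F[X]}
    (hf : IsTwistHomogeneous ζ f) (hfg : IsTwistHomogeneous ζ (f * g)) (hfm : f.Monic)
    (hgm : g.Monic) : IsTwistHomogeneous ζ g := by
  unfold IsTwistHomogeneous at *
  rw [mul_comp, hf, hfm.natDegree_mul hgm, pow_add, C_mul] at hfg
  have h0 : C (ζ ^ f.natDegree) * f ≠ 0 :=
    mul_ne_zero (C_ne_zero.2 (pow_ne_zero _ hζ)) hfm.ne_zero
  apply mul_left_cancel₀ h0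
  rw [hfg]
  ring

theorem IsTwistHomogeneous.coeff_eq_zero {ζ : F} (hζ : ζ ≠ 0) {f : F[X]}
    (hf : IsTwistHomogeneous ζ f) {i : ℕ} (hi : i ≤ f.natDegree)
    (h : ¬ orderOf ζ ∣ f.natDegree - i) : f.coeff i = 0 := by
  by_contra h0
  have hc := congrArg (fun p => coeff p i) hf
  simp only [comp_C_mul_X_coeff, coeff_C_mul] at hc
  rw [mul_comm] at hc
  have h1 := mul_right_cancel₀ h0 hc
  apply h
  rw [orderOf_dvd_iff_pow_eq_one]
  apply mul_right_cancel₀ (pow_ne_zero i hζ)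
  rw [← pow_add, Nat.sub_add_cancel hi, ← h1, one_mul]

/-- The monic twist-homogeneous polynomials of degree `c`. -/
abbrev MonicHomogeneous (ζ : F) (c : ℕ) : Type _ :=
  {h : F[X] // h.Monic ∧ h.natDegree = c ∧ IsTwistHomogeneous ζ h}

theorem natCard_monicHomogeneous [Fintype F] {ζ : F} (hζ : ζ ≠ 0) (c : ℕ) :
    Nat.card (MonicHomogeneous ζ c) = Fintype.card F ^ (c / orderOf ζ) := by
  set m := orderOf ζ with hm
  have hm0 : 0 < m := by
    rw [hm, orderOf_pos_iff, isOfFinOrder_iff_pow_eq_one]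
    exact ⟨Fintype.card F - 1, Nat.sub_pos_of_lt Fintype.one_lt_card,
      FiniteField.pow_card_sub_one_eq_one ζ hζ⟩
  have hζm : ζ ^ m = 1 := pow_orderOf_eq_one ζ
  have hle (j : Fin (c / m)) : (j + 1) * m ≤ c :=
    (Nat.mul_le_mul_right m j.2).trans (Nat.div_mul_le_self c m)
  trans Nat.card (Fin (c / m) → F)
  swap
  · simp
  refine Nat.card_congr (Equiv.ofBijective
    (fun h j => h.1.coeff (c - (j + 1) * m)) ⟨?_, ?_⟩)
  · rintro ⟨f, hfm, hfc, hf⟩ ⟨g, hgm, hgc, hg⟩ h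
    apply Subtype.ext
    ext i
    simp only
    rcases lt_trichotomy i c with hi | rfl | hi
    · by_cases hd : m ∣ c - i
      · obtain ⟨k, hk⟩ := hd
        obtain ⟨j, rfl⟩ : ∃ j, k = j + 1 := Nat.exists_eq_succ_of_ne_zero (by
          rintro rfl
          omega)
        have hj : j < c / m := by
          refine Nat.lt_of_succ_le ((Nat.le_div_iff_mul_le hm0).2 ?_)
          rw [mul_comm, Nat.succ_eq_add_one, ← hk]
          exact Nat.sub_le c i
        have := congrFun h ⟨j, hj⟩
        simp only at this
        rwa [mul_comm (j + 1), ← hk, Nat.sub_sub_self hi.le] at this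
      · rw [hf.coeff_eq_zero hζ (by omega) (by rwa [hfc]),
          hg.coeff_eq_zero hζ (by omega) (by rwa [hgc])]
    · conv_lhs => rw [← hfc]
      conv_rhs => rw [← hgc]
      rw [hfm.coeff_natDegree, hgm.coeff_natDegree]
    · rw [coeff_eq_zero_of_natDegree_lt (by omega), coeff_eq_zero_of_natDegree_lt (by omega)]
  · intro a
    set r : F[X] := ∑ j : Fin (c / m), C (a j) * X ^ (c - (j + 1) * m) with hr
    have hrdeg : r.degree < c := by
      refine (degree_sum_le _ _).trans_lt ((Finset.sup_lt_iff (WithBot.bot_lt_coe c)).2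
        fun j _ => ?_)
      refine (degree_C_mul_X_pow_le _ _).trans_lt ?_
      have := hle j
      have h1 : 0 < (j + 1 : ℕ) * m := by positivity
      exact WithBot.coe_lt_coe.2 (Nat.cast_lt.2 (by omega : c - (j + 1) * m < c))
    have hmonic : (X ^ c + r).Monic := monic_X_pow_add hrdeg
    have hdeg : (X ^ c + r).natDegree = c := by
      rw [natDegree_eq_of_degree_eq_some]
      rw [degree_add_eq_left_of_degree_lt (by rwa [degree_X_pow]), degree_X_pow]
    refine ⟨⟨X ^ c + r, hmonic, hdeg, ?_⟩, ?_⟩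
    · rw [IsTwistHomogeneous, hdeg, Polynomial.add_comp, mul_add, X_pow_comp, mul_pow, ← C_pow, hr,
        Polynomial.sum_comp, Finset.mul_sum]
      congr 1
      refine Finset.sum_congr rfl fun j _ => ?_
      have hpow : ζ ^ (c - (j + 1) * m) = ζ ^ c := by
        conv_rhs => rw [← Nat.sub_add_cancel (hle j), pow_add, pow_mul', hζm,
          one_pow, mul_one]
      rw [mul_comp, C_comp, X_pow_comp, mul_pow, ← C_pow, hpow]
      ring
    · funext k
      have hk := hle k
      have h1 : 0 < (k + 1 : ℕ) * m := by positivity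
      simp only [coeff_add, coeff_X_pow, hr, finsetSum_coeff, coeff_C_mul]
      rw [if_neg (by omega), zero_add, Finset.sum_eq_single k]
      · simp
      · intro j _ hjk
        rw [if_neg, mul_zero]
        intro h
        have hj := hle j
        apply hjk
        have h2 : ((j : ℕ) + 1) * m = (k + 1) * m := by omega
        have h3 := Nat.eq_of_mul_eq_mul_right hm0 h2
        exact Fin.ext (by omega)
      · simp

variable {V : Type*} [AddCommGroup V] [Module F V]

theorem similar_rootMul_smul {ζ : F} (hζ : ζ ≠ 0) {f : F[X]} (hfm : f.Monic)
    (hf : IsTwistHomogeneous ζ f) : Similar (rootMul f) (ζ • rootMul f) := by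
  have hroot : eval₂ (Algebra.ofId F (AdjoinRoot f) : F →+* AdjoinRoot f)
      (algebraMap F (AdjoinRoot f) ζ * AdjoinRoot.root f) f = 0 := by
    have h := congrArg (aeval (AdjoinRoot.root f)) hf
    rw [aeval_comp, map_mul, map_mul, aeval_C, aeval_X, AdjoinRoot.aeval_eq f, AdjoinRoot.mk_self,
      mul_zero] at h
    exact h
  set Ψ : AdjoinRoot f →ₐ[F] AdjoinRoot f :=
    AdjoinRoot.liftAlgHom f (Algebra.ofId F _) (algebraMap F _ ζ * AdjoinRoot.root f) hroot with hΨ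
  have hΨroot : Ψ (AdjoinRoot.root f) = algebraMap F _ ζ * AdjoinRoot.root f :=
    AdjoinRoot.liftAlgHom_root _ _ _ _
  have hsurj : Function.Surjective Ψ := by
    rw [← AlgHom.range_eq_top, eq_top_iff, ← AdjoinRoot.adjoinRoot_eq_top,
      Algebra.adjoin_le_iff, Set.singleton_subset_iff]
    refine ⟨algebraMap F _ ζ⁻¹ * AdjoinRoot.root f, ?_⟩
    change Ψ _ = _
    rw [map_mul, hΨroot, AlgHom.commutes, ← mul_assoc, ← map_mul, inv_mul_cancel₀ hζ, map_one,
      one_mul]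
  have := hfm.finite_adjoinRoot
  have hinj : Function.Injective Ψ.toLinearMap :=
    LinearMap.injective_iff_surjective.2 hsurj
  refine ⟨⟨LinearEquiv.ofBijective Ψ.toLinearMap ⟨hinj, hsurj⟩, fun x => ?_⟩⟩
  change Ψ (AdjoinRoot.root f * x) = ζ • (AdjoinRoot.root f * Ψ x)
  rw [map_mul, hΨroot, Algebra.smul_def, mul_assoc]

/-- `f(ζ X)` also annihilates `B`, and has the same degree as the minimal polynomial `f`. -/
theorem isTwistHomogeneous_minpoly {ζ : F} (hζ : ζ ≠ 0) [FiniteDimensional F V] {B : End F V}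
    (h : Similar B (ζ • B)) : IsTwistHomogeneous ζ (minpoly F B) := by
  have hmonic : (minpoly F B).Monic := minpoly.monic (Algebra.IsIntegral.isIntegral B)
  have hroot : aeval (ζ • B) (minpoly F B) = 0 := by
    rw [h.minpoly_eq]
    exact minpoly.aeval F _
  have hdvd : minpoly F B ∣ (minpoly F B).comp (C ζ * X) := by
    apply minpoly.dvd
    rwa [aeval_comp, map_mul, aeval_C, aeval_X, ← Algebra.smul_def]
  have hlin : (C ζ * X : F[X]).natDegree = 1 := natDegree_C_mul_X ζ hζ
  have hdeg : ((minpoly F B).comp (C ζ * X)).natDegree = (minpoly F B).natDegree := by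
    rw [natDegree_comp, hlin, mul_one]
  have hlc : ((minpoly F B).comp (C ζ * X)).leadingCoeff = ζ ^ (minpoly F B).natDegree := by
    rw [leadingCoeff_comp (by rw [hlin]; exact one_ne_zero), hmonic.leadingCoeff, one_mul,
      leadingCoeff_C_mul_X]
  rw [IsTwistHomogeneous, ← hlc]
  exact eq_leadingCoeff_mul_of_monic_of_dvd_of_natDegree_le hmonic hdvd hdeg.le

end Homogeneous

/-! ### Similarity classes stable under `ζ` -/

section Classes
open Module LinearMap Polynomial

variable {F : Type*} [Field F]

/-- Similarity as an equivalence relation on the endomorphisms of `Fⁿ`. -/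
def similarSetoid (F : Type*) [Field F] (n : ℕ) : Setoid (End F (Fin n → F)) where
  r := Similar
  iseqv := ⟨Similar.refl, Similar.symm, Similar.trans⟩

/-- The similarity classes of endomorphisms of `Fⁿ`. -/
abbrev SimilarityClass (F : Type*) [Field F] (n : ℕ) : Type _ := Quotient (similarSetoid F n)

/-- The similarity class of an endomorphism. -/
def simClass {n : ℕ} (B : End F (Fin n → F)) : SimilarityClass F n :=
  Quotient.mk (similarSetoid F n) B

theorem simClass_eq_iff {n : ℕ} {B C : End F (Fin n → F)} :
    simClass B = simClass C ↔ Similar B C := Quotient.eq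

/-- The similarity classes of endomorphisms `B` of `Fⁿ` that are similar to `ζ B`. -/
abbrev TwistedClass (ζ : F) (n : ℕ) : Type _ :=
  {c : SimilarityClass F n // ∃ B, simClass B = c ∧ Similar B (ζ • B)}

/-- The similarity classes of endomorphisms `B` of `Fⁿ` that are similar to `ζ B` and whose minimal
polynomial has degree `a`. -/
abbrev TwistedClassOfDegree (ζ : F) (n a : ℕ) : Type _ :=
  {c : SimilarityClass F n //
    ∃ B, simClass B = c ∧ Similar B (ζ • B) ∧ (minpoly F B).natDegree = a}

variable [Fintype F]

instance (n : ℕ) : Finite (SimilarityClass F n) :=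
  have : Finite (End F (Fin n → F)) := finite_linearMap
  inferInstance

/-- Burnside's count: the pairs `(A, B)` with `A` invertible and `A B A⁻¹ = ζ B` are counted by the
similarity classes that are stable under multiplication by `ζ`. -/
theorem natCard_nullityPair_zero (ζ : F) (n : ℕ) :
    Nat.card (NullityPair ζ (Fin n → F) 0) =
      Nat.card (TwistedClass ζ n) * Nat.card ((Fin n → F) ≃ₗ[F] (Fin n → F)) := by
  have : Finite (End F (Fin n → F)) := finite_linearMap
  have hinj (p : NullityPair ζ (Fin n → F) 0) : Function.Injective p.1.1.1 := by
    rw [← LinearMap.ker_eq_bot]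
    exact Submodule.finrank_eq_zero.1 p.2
  have hsim (p : NullityPair ζ (Fin n → F) 0) : Similar p.1.1.2 (ζ • p.1.1.2) :=
    ⟨⟨LinearEquiv.ofInjectiveEndo p.1.1.1 (hinj p), fun v => LinearMap.congr_fun p.1.2 v⟩⟩
  refine natCard_eq_mul_of_fiber
    (fun p => (⟨simClass p.1.1.2, _, rfl, hsim p⟩ : TwistedClass ζ n)) _ ?_
  rintro ⟨_, B₀, rfl, hB₀⟩
  -- Both the fibre and the general linear group map to the class of `B₀`, with fibres that are
  -- torsors under centralizers of elements of the class.
  trans Nat.card {B : End F (Fin n → F) // Similar B₀ B} * Nat.card (Intertwiner B₀ B₀)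
  · refine natCard_eq_mul_of_fiber
      (fun p => ⟨p.1.1.1.2, (simClass_eq_iff.1 (Subtype.mk.inj p.2)).symm⟩) _ ?_
    rintro ⟨B, hB⟩
    rw [← natCard_intertwiner_right hB, natCard_intertwiner_left hB,
      ← natCard_intertwiner_right (hB.symm.trans (hB₀.trans (hB.smul ζ)))]
    symm
    refine Nat.card_congr (Equiv.ofBijective
      (fun e => ⟨⟨⟨⟨(e.1.toLinearMap, B), ?_⟩, ?_⟩, ?_⟩, ?_⟩) ⟨?_, ?_⟩)
    · exact LinearMap.ext fun v => e.2 v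
    · exact (congrArg (fun K : Submodule F (Fin n → F) => finrank F K) e.1.ker).trans
        (finrank_bot F _)
    · exact Subtype.ext (simClass_eq_iff.2 hB.symm)
    · rfl
    · intro e e' h
      simp only [Subtype.mk.injEq, Prod.mk.injEq, and_true] at h
      exact Subtype.ext (LinearEquiv.toLinearMap_injective h)
    · rintro ⟨⟨⟨⟨⟨A, B'⟩, hAB⟩, hA⟩, h₁⟩, h₂⟩
      have hB' : B' = B := Subtype.mk.inj h₂
      subst hB'
      refine ⟨⟨LinearEquiv.ofInjectiveEndo A (hinj ⟨⟨(A, B'), hAB⟩, hA⟩),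
        fun v => LinearMap.congr_fun hAB v⟩, ?_⟩
      rfl
  · symm
    refine natCard_eq_mul_of_fiber
      (fun g : (Fin n → F) ≃ₗ[F] (Fin n → F) => ⟨g.conj B₀, ⟨⟨g, fun v => by simp⟩⟩⟩) _ ?_
    rintro ⟨B, hB⟩
    rw [← natCard_intertwiner_right hB]
    refine Nat.card_congr (Equiv.subtypeEquivRight fun g => ?_)
    rw [Subtype.ext_iff]
    constructor
    · rintro rfl v
      simp
    · intro h
      refine LinearMap.ext fun v => ?_
      simp [LinearEquiv.conj_apply, h]

omit [Fintype F] in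
theorem natDegree_minpoly_le {n : ℕ} (B : End F (Fin n → F)) : (minpoly F B).natDegree ≤ n := by
  have h := natDegree_le_of_dvd B.minpoly_dvd_charpoly B.charpoly_monic.ne_zero
  rwa [B.charpoly_natDegree, finrank_fin_fun] at h

theorem natCard_twistedClass (ζ : F) (n : ℕ) :
    Nat.card (TwistedClass ζ n) =
      ∑ a ∈ Finset.range (n + 1), Nat.card (TwistedClassOfDegree ζ n a) := by
  rw [← Fin.sum_univ_eq_sum_range (fun a => Nat.card (TwistedClassOfDegree ζ n a)),
    ← Nat.card_sigma]
  symm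
  refine Nat.card_congr (Equiv.ofBijective
    (fun x => ⟨x.2.1, x.2.2.imp fun B hB => ⟨hB.1, hB.2.1⟩⟩) ⟨?_, ?_⟩)
  · rintro ⟨a, _, B, rfl, hB, ha⟩ ⟨a', c', B', rfl, hB', ha'⟩ h
    have h₁ := simClass_eq_iff.1 (Subtype.mk.inj h)
    obtain rfl : a = a' := Fin.ext (by rw [← ha, ← ha', h₁.minpoly_eq])
    congr 1
    exact Subtype.ext (Subtype.mk.inj h)
  · rintro ⟨_, B, rfl, hB⟩
    exact ⟨⟨⟨_, Nat.lt_succ_of_le (natDegree_minpoly_le B)⟩, ⟨_, B, rfl, hB, rfl⟩⟩, rfl⟩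

omit [Fintype F] in
theorem natCard_twistedClassOfDegree_eq_zero (ζ : F) {n a : ℕ} (h : n < a) :
    Nat.card (TwistedClassOfDegree ζ n a) = 0 := by
  have : IsEmpty (TwistedClassOfDegree ζ n a) := by
    refine ⟨?_⟩
    rintro ⟨_, B, rfl, hB, ha⟩
    have := natDegree_minpoly_le B
    omega
  exact Nat.card_of_isEmpty

omit [Fintype F] in
theorem natCard_twistedClassOfDegree_zero (ζ : F) (n : ℕ) :
    Nat.card (TwistedClassOfDegree ζ n 0) = if n = 0 then 1 else 0 := by
  split_ifs with hn
  · subst hn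
    have hall (B C : End F (Fin 0 → F)) : B = C := by
      ext1 v
      exact Subsingleton.elim _ _
    have hdeg := natDegree_minpoly_le (0 : End F (Fin 0 → F))
    rw [Nat.card_eq_one_iff_unique]
    refine ⟨⟨?_⟩, ⟨⟨simClass 0, 0, rfl, ?_, by omega⟩⟩⟩
    · rintro ⟨_, B, rfl, -⟩ ⟨_, C, rfl, -⟩
      exact Subtype.ext (congrArg simClass (hall B C))
    · rw [smul_zero]
      exact Similar.refl 0
  · have : IsEmpty (TwistedClassOfDegree ζ n 0) := by
      refine ⟨?_⟩
      rintro ⟨_, B, rfl, hB, ha⟩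
      have hmonic : (minpoly F B).Monic := minpoly.monic (Algebra.IsIntegral.isIntegral B)
      have h := minpoly.aeval F B
      rw [eq_one_of_monic_natDegree_zero hmonic ha, map_one] at h
      have hn' : Nonempty (Fin n) := ⟨⟨0, Nat.pos_of_ne_zero hn⟩⟩
      exact one_ne_zero h
    exact Nat.card_of_isEmpty

/-- A relation that induces a one-to-one correspondence shows that two types have the same
cardinality. -/
theorem natCard_eq_of_relation {X Y : Type*} (ρ : X → Y → Prop) (hX : ∀ x, ∃ y, ρ x y)
    (hY : ∀ y, ∃ x, ρ x y) (h : ∀ x x' y y', ρ x y → ρ x' y' → (x = x' ↔ y = y')) :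
    Nat.card X = Nat.card Y := by
  choose f hf using hX
  refine Nat.card_congr (Equiv.ofBijective f ⟨fun x x' e => ?_, fun y => ?_⟩)
  · exact (h _ _ _ _ (hf x) (hf x')).2 e
  · obtain ⟨x, hx⟩ := hY y
    exact ⟨x, (h _ _ _ _ (hf x) hx).1 rfl⟩

omit [Fintype F] in
theorem similar_rootMul_of_eq {f g : F[X]} (h : f = g) : Similar (rootMul f) (rootMul g) := by
  subst h
  exact Similar.refl _

/-- Splitting off the summand `F[X] / (f)`, where `f` is the minimal polynomial, is a bijection from
the classes of `B` on `Fⁿ` with `deg f = a` to the pairs of a class of `C` on `Fⁿ⁻ᵃ` and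
the cofactor `h` of the minimal polynomial of `C` in `f`. -/
theorem natCard_twistedClassOfDegree_eq_sum {ζ : F} (hζ : ζ ≠ 0) {n a : ℕ} (ha : a ≤ n) :
    Nat.card (TwistedClassOfDegree ζ n a) =
      ∑ b ∈ Finset.range (a + 1),
        Fintype.card F ^ ((a - b) / orderOf ζ) * Nat.card (TwistedClassOfDegree ζ (n - a) b) := by
  have hmonic {k : ℕ} (B : End F (Fin k → F)) : (minpoly F B).Monic :=
    minpoly.monic (Algebra.IsIntegral.isIntegral B)
  rw [← Fin.sum_univ_eq_sum_range
    (fun b =>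
      Fintype.card F ^ ((a - b) / orderOf ζ) * Nat.card (TwistedClassOfDegree ζ (n - a) b))]
  simp only [← natCard_monicHomogeneous hζ, ← Nat.card_prod]
  have hfinH (c : ℕ) : Finite (MonicHomogeneous ζ c) := by
    apply Nat.finite_of_card_ne_zero
    rw [natCard_monicHomogeneous hζ]
    exact pow_ne_zero _ Fintype.card_ne_zero
  rw [← Nat.card_sigma]
  symm
  refine natCard_eq_of_relation
    (X := Σ b : Fin (a + 1), MonicHomogeneous ζ (a - b) × TwistedClassOfDegree ζ (n - a) b)
    (fun x c => ∃ (C : End F (Fin (n - a) → F)) (B : End F (Fin n → F)),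
      simClass C = x.2.2.1 ∧ simClass B = c.1 ∧
        Similar B ((rootMul (minpoly F C * x.2.1.1)).prodMap C)) ?_ ?_ ?_
  · rintro ⟨⟨b, hb⟩, ⟨h, hh, hdeg, hhom⟩, ⟨_, C, rfl, hC, hCb⟩⟩
    simp only at hdeg hCb
    have hfm := (hmonic C).mul hh
    have hfdeg : (minpoly F C * h).natDegree = a := by
      rw [(hmonic C).natDegree_mul hh, hdeg, hCb]
      omega
    have hfhom := (isTwistHomogeneous_minpoly hζ hC).mul hhom (hmonic C) hh
    have := hfm.finite_adjoinRoot
    have := hfm.free_adjoinRoot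
    have hrank : finrank F (AdjoinRoot (minpoly F C * h)) = a :=
      finrank_quotient_span_eq_natDegree.trans hfdeg
    obtain ⟨B, hB⟩ := exists_similar_of_finrank_eq (n := n)
      (by rw [finrank_prod, hrank, finrank_fin_fun]; omega)
      ((rootMul (minpoly F C * h)).prodMap C)
    refine ⟨⟨simClass B, B, rfl, ?_, ?_⟩, C, B, rfl, rfl, hB.symm⟩
    · refine hB.symm.trans (Similar.trans ?_ (hB.smul ζ))
      exact (similar_rootMul_smul hζ hfm hfhom).prodMap hC
    · rw [← hB.minpoly_eq, minpoly_rootMul_prodMap hfm (dvd_mul_right _ _), hfdeg]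
  · rintro ⟨_, B, rfl, hB, rfl⟩
    obtain ⟨C, hBC⟩ := exists_similar_rootMul_prodMap B
    have hfm := hmonic B
    have hfhom := isTwistHomogeneous_minpoly hζ hB
    have := hfm.finite_adjoinRoot
    have : Finite (AdjoinRoot (minpoly F B)) := Module.finite_of_finite F
    have hC : Similar C (ζ • C) := by
      refine Similar.cancel_left (D := rootMul (minpoly F B)) ?_
      refine (hBC.symm.trans (hB.trans (hBC.smul ζ))).trans ?_
      change Similar ((ζ • rootMul (minpoly F B)).prodMap (ζ • C)) _
      exact (similar_rootMul_smul hζ hfm hfhom).symm.prodMap (Similar.refl _)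
    obtain ⟨h, hh⟩ : minpoly F C ∣ minpoly F B :=
      (minpoly_dvd_minpoly_prodMap _ _).trans hBC.minpoly_eq.symm.dvd
    have hhm : h.Monic := (hmonic C).of_mul_monic_left (hh ▸ hfm)
    have hdeg : (minpoly F B).natDegree = (minpoly F C).natDegree + h.natDegree := by
      conv_lhs => rw [hh, (hmonic C).natDegree_mul hhm]
    have hhom : IsTwistHomogeneous ζ h :=
      (isTwistHomogeneous_minpoly hζ hC).of_mul_left hζ (hh ▸ hfhom) (hmonic C) hhm
    refine ⟨⟨⟨(minpoly F C).natDegree, by omega⟩, ⟨h, hhm, ?_, hhom⟩, ⟨_, C, rfl, hC, rfl⟩⟩,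
      C, B, rfl, rfl, ?_⟩
    · simp only
      omega
    · exact hBC.trans ((similar_rootMul_of_eq hh).prodMap (Similar.refl C))
  · rintro ⟨b, ⟨h, hh, hdeg, hhom⟩, ⟨c, hc⟩⟩ ⟨b', ⟨h', hh', hdeg', hhom'⟩, ⟨c', hc'⟩⟩
      ⟨d, hd⟩ ⟨d', hd'⟩ ⟨C, B, rfl, rfl, hB⟩ ⟨C', B', rfl, rfl, hB'⟩
    simp only at hB hB'
    have hfm := (hmonic C).mul hh
    have hfm' := (hmonic C').mul hh'
    have hBmin : minpoly F B = minpoly F C * h := by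
      rw [hB.minpoly_eq, minpoly_rootMul_prodMap hfm (dvd_mul_right _ _)]
    have hBmin' : minpoly F B' = minpoly F C' * h' := by
      rw [hB'.minpoly_eq, minpoly_rootMul_prodMap hfm' (dvd_mul_right _ _)]
    constructor
    · intro e
      have hCC' : Similar C C' ∧ h = h' := by
        obtain ⟨rfl, e⟩ := Sigma.mk.inj_iff.1 e
        have e := eq_of_heq e
        simp only [Prod.mk.injEq, Subtype.mk.injEq] at e
        exact ⟨simClass_eq_iff.1 e.2, e.1⟩
      refine Subtype.ext (simClass_eq_iff.2 (hB.trans (Similar.trans ?_ hB'.symm)))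
      exact (similar_rootMul_of_eq (by rw [hCC'.1.minpoly_eq, hCC'.2])).prodMap hCC'.1
    · intro e
      have hBB' : Similar B B' := simClass_eq_iff.1 (Subtype.mk.inj e)
      have hff' : minpoly F C' * h' = minpoly F C * h := by
        rw [← hBmin, ← hBmin', hBB'.minpoly_eq]
      have := hfm.finite_adjoinRoot
      have : Finite (AdjoinRoot (minpoly F C * h)) := Module.finite_of_finite F
      have hCC' : Similar C C' := by
        refine Similar.cancel_left (D := rootMul (minpoly F C * h)) ?_
        refine hB.symm.trans (hBB'.trans (hB'.trans ?_))
        exact (similar_rootMul_of_eq hff').prodMap (Similar.refl C')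
      have hhh' : h = h' := by
        rw [hCC'.minpoly_eq] at hff'
        exact (mul_left_cancel₀ (hmonic C').ne_zero hff').symm
      subst hhh'
      obtain rfl : b = b' := Fin.ext (by omega)
      have hcc' := simClass_eq_iff.2 hCC'
      congr 2
      exact Subtype.ext hcc'

end Classes

/-! ### The generating function -/

section Main
open PowerSeries Module

variable {F : Type*} [Field F] [Fintype F]

local notation "q" => (Fintype.card F : ℝ)

/-- The column `a = 0` of the recursion is `1`: the minimal polynomial has degree `0` only on the
zero space. -/
theorem mk_natCard_twistedClass {ζ : F} (hζ : ζ ≠ 0) :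
    (mk fun n => (Nat.card (TwistedClass ζ n) : ℝ)) =
      ∏' i : ℕ, expand (i + 1) i.succ_ne_zero (mk fun c => q ^ (c / orderOf ζ)) := by
  have h := mk_sum_eq_tprod_mul (fun c => q ^ (c / orderOf ζ)) (by simp)
    (fun n a => (Nat.card (TwistedClassOfDegree ζ n a) : ℝ))
    (fun n a h => by simp only [natCard_twistedClassOfDegree_eq_zero ζ h, Nat.cast_zero])
    (fun n a _ ha => by
      simp only [natCard_twistedClassOfDegree_eq_sum hζ ha]
      push_cast
      rfl)
  have h1 : (mk fun n => (Nat.card (TwistedClassOfDegree ζ n 0) : ℝ)) = 1 := by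
    ext n
    rw [coeff_mk, natCard_twistedClassOfDegree_zero, coeff_one]
    push_cast
    rfl
  rw [h1, mul_one] at h
  rw [← h]
  congr 1
  funext n
  rw [natCard_twistedClass]
  push_cast
  rfl

omit [Fintype F] in
theorem ncard_zetaCommuting (ζ : F) (n : ℕ) :
    (zetaCommuting ζ n).ncard = Nat.card (TwistedPair ζ (Fin n → F)) := by
  rw [← Nat.card_coe_set_eq]
  refine Nat.card_congr ((Equiv.prodCongr Matrix.toLinAlgEquiv'.toEquiv
    Matrix.toLinAlgEquiv'.toEquiv).subtypeEquiv fun p => ?_)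
  change p.1 * p.2 = ζ • (p.2 * p.1) ↔ Matrix.toLinAlgEquiv' p.1 * Matrix.toLinAlgEquiv' p.2 =
    ζ • (Matrix.toLinAlgEquiv' p.2 * Matrix.toLinAlgEquiv' p.1)
  rw [← map_mul, ← map_mul, ← map_smul]
  exact (Matrix.toLinAlgEquiv'.injective.eq_iff).symm

theorem ncard_div_glOrder (ζ : F) (n : ℕ) :
    ((zetaCommuting ζ n).ncard : ℝ) / glOrder q n =
      ∑ a ∈ Finset.range (n + 1), nullityRatio ζ n a := by
  have h := finsum_twistedPair_eq_sum ζ n fun _ => 1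
  have : Fintype (TwistedPair ζ (Fin n → F)) := Fintype.ofFinite _
  rw [finsum_eq_sum_of_fintype, Finset.sum_const, Finset.card_univ, ← Nat.card_eq_fintype_card,
    ← ncard_zetaCommuting, nsmul_eq_mul, mul_one] at h
  simp only [one_mul] at h
  rw [h, Finset.sum_div]
  rfl

theorem normalizedSeries_eq {ζ : F} (hζ : ζ ≠ 0) :
    normalizedSeries q (fun n => (zetaCommuting ζ n).ncard) =
      (∏' i : ℕ, expand (i + 1) i.succ_ne_zero (mk (eulerCoeff q))) *
        ∏' i : ℕ, expand (i + 1) i.succ_ne_zero (mk fun c => q ^ (c / orderOf ζ)) := by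
  rw [← mk_natCard_twistedClass hζ]
  have h := mk_sum_eq_tprod_mul (eulerCoeff q) (eulerCoeff_zero q) (nullityRatio ζ)
    (fun n a => nullityRatio_eq_zero ζ) (fun n a _ ha => nullityRatio_recursion hζ ha)
  have h0 (n : ℕ) : nullityRatio ζ n 0 = Nat.card (TwistedClass ζ n) := by
    rw [nullityRatio, natCard_nullityPair_zero, Nat.cast_mul, natCard_linearEquiv_self,
      finrank_fin_fun, mul_div_cancel_right₀ _ (glOrder_pos one_lt_card_cast n).ne']
  simp only [h0, ← ncard_div_glOrder] at h
  exact h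

end Main
end QuantumPlane

theorem theorem2 {F : Type*} [Field F] [Fintype F] (q : ℕ) (hq : Fintype.card F = q)
    (ζ : F) (hζ : ζ ≠ 0) (m : ℕ) (hm : orderOf ζ = m) :
    -- the infinite product in the definition of `F_m(x; q)` converges
    Multipliable (QuantumPlane.eulerFactor (q : ℝ)) ∧
    -- the product of the `F_m(x^i; q)` over `i ≥ 1` converges to the generating function
    HasProd
      (fun i : ℕ =>
        PowerSeries.expand (i + 1) (Nat.succ_ne_zero i) (QuantumPlane.quantumFactor m (q : ℝ)))
      (QuantumPlane.normalizedSeries (q : ℝ)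
        fun n => (QuantumPlane.zetaCommuting ζ n).ncard) ∧
    -- the count depends on `ζ` only through its order
    (∀ ζ' : F, ζ' ≠ 0 → orderOf ζ' = m → ∀ n : ℕ,
      (QuantumPlane.zetaCommuting ζ' n).ncard = (QuantumPlane.zetaCommuting ζ n).ncard) ∧
    -- in the case `m = 1` this is the generating function of Feit and Fine for commuting pairs
    (m = 1 →
      (∀ n : ℕ, QuantumPlane.zetaCommuting ζ n =
        {p : Matrix (Fin n) (Fin n) F × Matrix (Fin n) (Fin n) F | Commute p.1 p.2}) ∧
      (∀ i : ℕ, Multipliable fun j : ℕ =>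
        (1 - PowerSeries.C ((q : ℝ) ^ (1 - (j : ℤ))) * PowerSeries.X ^ (i + 1) :
          PowerSeries ℝ)) ∧
      HasProd
        (fun i : ℕ => (∏' j : ℕ,
          (1 - PowerSeries.C ((q : ℝ) ^ (1 - (j : ℤ))) * PowerSeries.X ^ (i + 1) :
            PowerSeries ℝ))⁻¹)
        (QuantumPlane.normalizedSeries (q : ℝ) fun n =>
          {p : Matrix (Fin n) (Fin n) F × Matrix (Fin n) (Fin n) F | Commute p.1 p.2}.ncard)) := by
  subst hq
  have hq1 := QuantumPlane.one_lt_card_cast (F := F)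
  have hm0 : 0 < m := by
    rw [← hm, orderOf_pos_iff, isOfFinOrder_iff_pow_eq_one]
    exact ⟨Fintype.card F - 1, Nat.sub_pos_of_lt Fintype.one_lt_card,
      FiniteField.pow_card_sub_one_eq_one ζ hζ⟩
  have hseries (ξ : F) (hξ : ξ ≠ 0) (hξm : orderOf ξ = m) :=
    hξm ▸ QuantumPlane.normalizedSeries_eq hξ
  have hprod := QuantumPlane.hasProd_expand_quantumFactor hq1 hm0
  rw [← hseries ζ hζ hm] at hprod
  refine ⟨QuantumPlane.multipliable_eulerFactor hq1, hprod, ?_, ?_⟩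
  · intro ξ hξ hξm n
    have h := (hseries ξ hξ hξm).trans (hseries ζ hζ hm).symm
    have hn := congrArg (PowerSeries.coeff n) h
    simp only [QuantumPlane.normalizedSeries, PowerSeries.coeff_mk] at hn
    rw [div_left_inj' (QuantumPlane.glOrder_pos hq1 n).ne'] at hn
    exact_mod_cast hn
  · rintro rfl
    have hset (n : ℕ) : QuantumPlane.zetaCommuting ζ n =
        {p : Matrix (Fin n) (Fin n) F × Matrix (Fin n) (Fin n) F | Commute p.1 p.2} := by
      ext p
      rw [orderOf_eq_one_iff] at hm
      simp [QuantumPlane.zetaCommuting, hm, Commute, SemiconjBy]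
    refine ⟨hset, QuantumPlane.multipliable_feitFine hq1, ?_⟩
    simp only [← hset, QuantumPlane.inv_tprod_feitFine hq1]
    exact hprod
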